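/- Let $q=2^h$ and let $Q^+(5,q)$ be a hyperbolic quadric of $\mathrm{PG}(5,q)$ with associated symplectic polarity $\zeta$. Let $\Pi$ be a $3$-dimensional subspace of $\mathrm{PG}(5,q)$ that meets $Q^+(5,q)$ in an elliptic quadric $Q^-(3,q)$, and let $W(q)$ be the generalized quadrangle whose points are the points of $\Pi$ and whose lines are the lines of $\Pi$ tangent to $Q^-(3,q)$ (i.e. meeting it in exactly one point). An ovoid of $W(q)$ is a set of points of $\Pi$ meeting every line of $W(q)$ in exactly one point; it is classical if it is an elliptic quadric of $\Pi$. For a point $x\in\Pi\setminus Q^-(3,q)$, let $\pi_x$ be the plane of $\Pi$ generated by the lines of $W(q)$ through $x$ and let $\mathcal C_x:=\pi_x^\zeta\cap Q^+(5,q)$. For an ovoid $O\neq Q^-(3,q)$ of $W(q)$, put $$H_O:=\Big(\bigcup_{x\in O\setminus Q^-(3,q)}\mathcal C_x\Big)\cup\big(Q^-(3,q)\setminus O\big).$$ Call two sets of points of $Q^+(5,q)$ isomorphic if some automorphism of $\mathrm{PG}(5,q)$ (an element of $\mathrm{P\Gamma L}(6,q)$) stabilizing $Q^+(5,q)$ maps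 one to the other. Let $N$ be the number of orbits of $\mathrm{Aut}(\mathbb F_q)$ on the set of all nonzero $x\in\mathbb F_q$ with $x+x^2+x^4+\cdots+x^{2^{h-1}}=0$. Then for every classical ovoid $O\neq Q^-(3,q)$ of $W(q)$ the set $H_O$ is a hyperoval of $Q^+(5,q)$, i.e. a nonempty set of points of $Q^+(5,q)$ meeting each line contained in $Q^+(5,q)$ in $0$ or $2$ points, and the number of isomorphism classes of these hyperovals $H_O$ is equal to $N+1$. -/

import Mathlib

open scoped LinearAlgebra.Projectivization

namespace KleinHyperoval

variable {F V : Type*} [Field F] [AddCommGroup V] [Module F V]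

/-- The form `Q` is hyperbolic of rank 6: in a suitable coordinate system it is
`X₁X₂ + X₃X₄ + X₅X₆`, so that its zeros form a hyperbolic quadric `Q⁺(5,q)` of `PG(V)`. -/
def IsHyperbolic (Q : QuadraticForm F V) : Prop :=
  ∃ b : Module.Basis (Fin 6) F V, ∀ v : V,
    Q v = b.repr v 0 * b.repr v 1 + b.repr v 2 * b.repr v 3 + b.repr v 4 * b.repr v 5

/-- The set of points of the quadric of `PG(V)` with equation `Q = 0`. -/
def quadric (Q : QuadraticForm F V) : Set (ℙ F V) :=
  {p | ∀ v ∈ p.submodule, Q v = 0}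

/-- The set of points of the projective subspace of `PG(V)` given by the vector subspace `S`. -/
def pointsOf (S : Submodule F V) : Set (ℙ F V) :=
  {p | p.submodule ≤ S}

/-- `E` is an elliptic quadric of the solid `S`: in a suitable coordinate system of `S` it has
equation `X₁X₂ + g(X₃,X₄) = 0`, with `g` a binary quadratic form that is irreducible over `F`
(that is, without nontrivial zeros). -/
def IsEllipticQuadric (S : Submodule F V) (E : Set (ℙ F V)) : Prop :=
  ∃ (b : Module.Basis (Fin 4) F S) (a c d : F),
    (∀ s t : F, a * s ^ 2 + c * (s * t) + d * t ^ 2 = 0 → s = 0 ∧ t = 0) ∧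
    E = {p | p.submodule ≤ S ∧ ∀ w : S, (w : V) ∈ p.submodule →
      b.repr w 0 * b.repr w 1 +
        (a * b.repr w 2 ^ 2 + c * (b.repr w 2 * b.repr w 3) + d * b.repr w 3 ^ 2) = 0}

/-- The set `Q⁻(3,q)` of the points of the quadric `Q = 0` in the subspace `S`. -/
def sectionOf (Q : QuadraticForm F V) (S : Submodule F V) : Set (ℙ F V) :=
  pointsOf S ∩ quadric Q

/-- The lines of `W(q)`: the lines of `S` tangent to `S ∩ {Q = 0}`, that is, meeting it in
exactly one point. -/
def IsTangentLine (Q : QuadraticForm F V) (S L : Submodule F V) : Prop :=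
  L ≤ S ∧ Module.finrank F L = 2 ∧ ∃! p : ℙ F V, p ∈ pointsOf L ∩ sectionOf Q S

/-- An ovoid of `W(q)`: a set of points of `S` meeting every line of `W(q)` in exactly one
point. -/
def IsOvoid (Q : QuadraticForm F V) (S : Submodule F V) (O : Set (ℙ F V)) : Prop :=
  O ⊆ pointsOf S ∧ ∀ L, IsTangentLine Q S L → ∃! p : ℙ F V, p ∈ pointsOf L ∩ O

/-- The plane `π_x` of `S`, generated by the lines of `W(q)` through the point `x`. -/
def tangentSpan (Q : QuadraticForm F V) (S : Submodule F V) (x : ℙ F V) : Submodule F V :=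
  sSup {L | IsTangentLine Q S L ∧ x ∈ pointsOf L}

/-- The subspace `T^ζ`, with `ζ` the polarity associated with `Q`. -/
def polar (Q : QuadraticForm F V) (T : Submodule F V) : Submodule F V :=
  LinearMap.BilinForm.orthogonal (QuadraticMap.polarBilin Q) T

/-- The conic `𝒞_x = π_x^ζ ∩ Q⁺(5,q)`. -/
def conic (Q : QuadraticForm F V) (S : Submodule F V) (x : ℙ F V) : Set (ℙ F V) :=
  pointsOf (polar Q (tangentSpan Q S x)) ∩ quadric Q

/-- The set `H_O`. -/
def hyperovalOf (Q : QuadraticForm F V) (S : Submodule F V) (O : Set (ℙ F V)) : Set (ℙ F V) :=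
  (⋃ x ∈ O \ sectionOf Q S, conic Q S x) ∪ (sectionOf Q S \ O)

/-- A hyperoval of the point-line geometry of the quadric `Q = 0`: a nonempty set of points of
the quadric that meets every line contained in the quadric in 0 or 2 points. -/
def IsHyperoval (Q : QuadraticForm F V) (H : Set (ℙ F V)) : Prop :=
  H ⊆ quadric Q ∧ H.Nonempty ∧
    ∀ L : Submodule F V, Module.finrank F L = 2 → pointsOf L ⊆ quadric Q →
      (pointsOf L ∩ H).encard = 0 ∨ (pointsOf L ∩ H).encard = 2

/-- The group `PΓL(V)` of automorphisms of `PG(V)`: the permutations of the points that are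
induced by bijective semilinear maps. -/
def PGammaL (F V : Type*) [Field F] [AddCommGroup V] [Module F V] :
    Subgroup (Equiv.Perm (ℙ F V)) where
  carrier := {e | ∃ (σ : F ≃+* F) (g : V ≃+ V), (∀ (a : F) (v : V), g (a • v) = σ a • g v) ∧
    ∀ (v : V) (hv : v ≠ 0),
      e (Projectivization.mk F v hv) =
        Projectivization.mk F (g v) ((map_ne_zero_iff g g.injective).mpr hv)}
  one_mem' := ⟨RingEquiv.refl F, AddEquiv.refl V, fun _ _ => rfl, fun _ _ => rfl⟩
  mul_mem' := by
    rintro e₁ e₂ ⟨σ₁, g₁, h₁, k₁⟩ ⟨σ₂, g₂, h₂, k₂⟩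
    refine ⟨σ₂.trans σ₁, g₂.trans g₁, fun a v => ?_, fun v hv => ?_⟩
    · simp [h₁, h₂]
    · simp [Equiv.Perm.mul_apply, k₁, k₂]
  inv_mem' := by
    rintro e ⟨σ, g, h, k⟩
    refine ⟨σ.symm, g.symm, fun a v => ?_, fun v hv => ?_⟩
    · apply g.injective
      simp [h]
    · rw [Equiv.Perm.inv_eq_iff_eq, k]
      simp

/-- Two sets of points of the quadric `Q = 0` are isomorphic if some automorphism of `PG(V)`
that stabilizes the quadric maps the one to the other. -/
def isoSetoid (Q : QuadraticForm F V) : Setoid (Set (ℙ F V)) where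
  r H₁ H₂ := ∃ e ∈ PGammaL F V, e '' quadric Q = quadric Q ∧ e '' H₁ = H₂
  iseqv :=
    { refl := fun H => ⟨1, one_mem _, by simp, by simp⟩
      symm := by
        rintro H₁ H₂ ⟨e, he, hq, rfl⟩
        refine ⟨e⁻¹, inv_mem he, ?_, ?_⟩
        · conv_lhs => rw [← hq]
          simp [Set.image_image]
        · simp [Set.image_image]
      trans := by
        rintro H₁ H₂ H₃ ⟨e, he, hq, rfl⟩ ⟨e', he', hq', rfl⟩
        refine ⟨e' * e, mul_mem he' he, ?_, ?_⟩
        · rw [Equiv.Perm.coe_mul, Set.image_comp, hq, hq']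
        · rw [Equiv.Perm.coe_mul, Set.image_comp] }

/-- The sets `H_O`, with `O` a classical ovoid of `W(q)` (an ovoid of `W(q)` that is an elliptic
quadric of `S`) distinct from `Q⁻(3,q)`. -/
def classicalHyperovals (Q : QuadraticForm F V) (S : Submodule F V) : Set (Set (ℙ F V)) :=
  {H | ∃ O, IsOvoid Q S O ∧ IsEllipticQuadric S O ∧ O ≠ sectionOf Q S ∧ H = hyperovalOf Q S O}

/-- The number of isomorphism classes of the sets in `𝓗`. -/
noncomputable def numIsoClasses (Q : QuadraticForm F V) (𝓗 : Set (Set (ℙ F V))) : ℕ :=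
  (Quotient.mk (isoSetoid Q) '' 𝓗).ncard

/-- The trace `x + x² + x⁴ + ⋯ + x^(2^(h-1))` of an element of the field with `2^h` elements. -/
def trace (h : ℕ) (x : F) : F :=
  ∑ i ∈ Finset.range h, x ^ 2 ^ i

/-- The number of orbits of `Aut(F)` on the set of nonzero elements of trace 0. -/
noncomputable def numTraceZeroOrbits (F : Type*) [Field F] (h : ℕ) : ℕ :=
  (Quotient.mk (MulAction.orbitRel (RingAut F) F) '' {x : F | x ≠ 0 ∧ trace h x = 0}).ncard

end KleinHyperoval

/-! Write B for the polar form of Q. Since q is even, B is alternating, and the lines of W(q) are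
the lines of S that are totally isotropic for B (`isTangentLine_iff`). If a classical ovoid O has
equation P = 0, uniqueness of the zero on each such line makes the polar form of P proportional to
B. After scaling, P + Q has zero polar form, so it is the square of a linear form B(a,·). Thus O is
the zero set of Q(w) + B(a,w)² for some a in S (`exists_zeroSet_shiftedForm`), and a ≠ 0 because O ≠
Q⁻(3,q). For a ≠ 0 this set is a classical ovoid exactly when Q(a) = t² + t for some t, that is,
when Q(a) has trace 0 (`classicalHyperovals_eq`, `trace_eq_zero_iff`).

Everything is then computed in coordinates adapted to a (`exists_isAdapted`): Q = Q(a)x₀² + x₀x₁ +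
N(x₂,x₃) + N(x₄,x₅) with N(x,y) = x² + xy + δy² anisotropic, a = e₀, and S given by x₄ = x₅ = 0.
There H_O consists of the singular points with x₁ ≠ 0 and N(x₄,x₅) equal to 0 or x₁²
(`mk_mem_hyperovalOf`). In the affine (x₄,x₅)-plane this condition describes a conic with its
nucleus, a planar hyperoval, and this yields the intersection numbers 0 and 2 (`isHyperoval`).

The shape of these coordinates shows that Q(a), up to field automorphisms, determines H_O up to
isomorphism (`isoSetoid_of_map_eq`). Conversely Q(a) is recovered from H_O
(`exists_map_eq_of_isoSetoid`). The singular points k whose perp misses H_O are pairwise orthogonal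
if Q(a) = 0, but not otherwise; if Q(a) ≠ 0, the only point orthogonal to all of them is ⟨a⟩. So an
isomorphism g, with Q(g v) = μσ(Q v), sends a to some t a'. For q > 4, the geometry of H_O forces μ
= t², and hence σ(Q(a)) = Q(a'); for q ≤ 4 the only possible nonzero value is 1. As Q takes every
value on nonzero vectors of S, the classes correspond to the orbits on all trace-0 elements: the N
nonzero ones and the orbit {0}. -/

namespace KleinHyperoval

/-! ### Trace, Artin–Schreier values and the anisotropic binary form. -/

section ArtinSchreier

variable {F : Type*} [Field F]

/-- `c` is a value of the Artin–Schreier map `t ↦ t² + t`. -/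
def IsArtinSchreier (c : F) : Prop := ∃ t : F, t ^ 2 + t = c

theorem charP_two_of_card [Fintype F] {h : ℕ} (hq : Fintype.card F = 2 ^ h) : CharP F 2 := by
  obtain ⟨p, hp⟩ := CharP.exists F
  have hprime : p.Prime := (CharP.char_is_prime F p)
  have hdvd : p ∣ 2 ^ h := by
    rw [← hq, ← CharP.cast_eq_zero_iff F p]
    exact Nat.cast_card_eq_zero F
  have : p = 2 := (Nat.prime_dvd_prime_iff_eq hprime Nat.prime_two).1 (hprime.dvd_of_dvd_pow hdvd)
  exact this ▸ hp

theorem isArtinSchreier_zero : IsArtinSchreier (0 : F) := ⟨0, by simp⟩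

theorem IsArtinSchreier.map {c : F} (hc : IsArtinSchreier c) (σ : F ≃+* F) :
    IsArtinSchreier (σ c) := by
  obtain ⟨t, rfl⟩ := hc
  exact ⟨σ t, by simp⟩

theorem isArtinSchreier_map_iff {c : F} (σ : F ≃+* F) :
    IsArtinSchreier (σ c) ↔ IsArtinSchreier c :=
  ⟨fun h => by simpa using h.map σ.symm, fun h => h.map σ⟩

/-- The trace is a nonzero polynomial of degree 2^(h-1) < q, so it cannot vanish at all q elements.
-/
theorem exists_trace_ne_zero [Fintype F] {h : ℕ} (hq : Fintype.card F = 2 ^ h) :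
    ∃ x : F, trace h x ≠ 0 := by
  by_contra! H
  have hh : h ≠ 0 := by
    rintro rfl
    have := Fintype.one_lt_card (α := F)
    simp_all
  obtain ⟨n, rfl⟩ := Nat.exists_eq_succ_of_ne_zero hh
  let p : Polynomial F := ∑ i ∈ Finset.range (n + 1), Polynomial.X ^ 2 ^ i
  have hp : p = 0 := by
    apply Polynomial.eq_zero_of_natDegree_lt_card_of_eval_eq_zero' p Finset.univ
    · intro x _
      simpa [p, Polynomial.eval_finsetSum, trace] using H x
    · rw [Finset.card_univ, hq]
      refine lt_of_le_of_lt (Polynomial.natDegree_sum_le_of_forall_le (n := 2 ^ n) _ _ ?_)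
        (Nat.pow_lt_pow_right (by norm_num) (Nat.lt_succ_self n))
      intro i hi
      rw [Polynomial.natDegree_X_pow]
      exact Nat.pow_le_pow_right (by norm_num) (Nat.lt_succ_iff.1 (Finset.mem_range.1 hi))
  have hc : p.coeff (2 ^ n) = 1 := by
    simp only [p, Polynomial.finsetSum_coeff, Polynomial.coeff_X_pow]
    rw [Finset.sum_eq_single n]
    · simp
    · intro i _ hi
      rw [if_neg]
      exact fun h => hi ((Nat.pow_right_injective le_rfl h).symm)
    · simp
  simp [hp] at hc

/-- The norm-like binary form `x² + xy + d y²`. -/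
def binForm (d x y : F) : F := x ^ 2 + x * y + d * y ^ 2

theorem binForm_smul (d t x y : F) : binForm d (t * x) (t * y) = t ^ 2 * binForm d x y := by
  unfold binForm; ring

variable [CharP F 2]

theorem exists_sq_eq [Finite F] (x : F) : ∃ y : F, y ^ 2 = x := by
  obtain ⟨y, hy⟩ := FiniteField.isSquare_of_char_two (ringChar.eq F 2).symm.symm x
  exact ⟨y, by rw [hy, sq]⟩

theorem sq_inj_two {x y : F} (h : x ^ 2 = y ^ 2) : x = y := by
  have h1 : (x + y) ^ 2 = 0 := by
    rw [CharTwo.add_sq, h, CharTwo.add_self_eq_zero]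
  exact CharTwo.add_eq_zero.1 (pow_eq_zero_iff two_ne_zero |>.1 h1)

/-- The Artin–Schreier map as an additive homomorphism. -/
def artinSchreierHom (F : Type*) [Field F] [CharP F 2] : F →+ F where
  toFun t := t ^ 2 + t
  map_zero' := by simp
  map_add' x y := by rw [CharTwo.add_sq]; ring

theorem IsArtinSchreier.add {c d : F} (hc : IsArtinSchreier c) (hd : IsArtinSchreier d) :
    IsArtinSchreier (c + d) :=
  (artinSchreierHom F).range.add_mem hc hd

/-- The kernel of t ↦ t² + t is {0, 1}, so the image is half of the field. -/
theorem index_artinSchreierHom_range [Finite F] : (artinSchreierHom F).range.index = 2 := by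
  have hk : Nat.card (artinSchreierHom F).ker = 2 := by
    have : ((artinSchreierHom F).ker : Set F) = {0, 1} := by
      ext t
      have : (artinSchreierHom F) t = t * (t + 1) := by
        change t ^ 2 + t = _
        ring
      simp only [SetLike.mem_coe, AddMonoidHom.mem_ker, this, mul_eq_zero, CharTwo.add_eq_zero,
        Set.mem_insert_iff, Set.mem_singleton_iff]
    change Nat.card ((artinSchreierHom F).ker : Set F) = 2
    rw [this, Nat.card_coe_set_eq, Set.ncard_pair zero_ne_one]
  have h1 := (artinSchreierHom F).ker.card_mul_index
  rw [AddSubgroup.index_ker, hk] at h1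
  have h2 := (artinSchreierHom F).range.card_mul_index
  have h3 : 0 < Nat.card (artinSchreierHom F).range := Nat.card_pos
  rw [← h1, mul_comm 2] at h2
  exact Nat.eq_of_mul_eq_mul_left h3 h2

theorem isArtinSchreier_add_of_not [Finite F] {c d : F} (hc : ¬ IsArtinSchreier c)
    (hd : ¬ IsArtinSchreier d) : IsArtinSchreier (c + d) :=
  (AddSubgroup.add_mem_iff_of_index_two index_artinSchreierHom_range).2
    ⟨fun h => absurd h hc, fun h => absurd h hd⟩

theorem exists_not_isArtinSchreier (F : Type*) [Field F] [CharP F 2] [Finite F] :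
    ∃ d : F, ¬ IsArtinSchreier d := by
  by_contra! h
  have : (artinSchreierHom F).range = ⊤ := by
    ext x
    exact iff_of_true (h x) trivial
  have h2 := index_artinSchreierHom_range (F := F)
  rw [this] at h2
  simp at h2

theorem trace_add (h : ℕ) (x y : F) : trace h (x + y) = trace h x + trace h y := by
  simp only [trace, add_pow_char_pow, Finset.sum_add_distrib]

theorem trace_sq_add (h : ℕ) (t : F) : trace h (t ^ 2 + t) = t ^ 2 ^ h + t := by
  induction h with
  | zero => simp [trace, CharTwo.add_self_eq_zero]
  | succ n ih =>
    have : trace (n + 1) (t ^ 2 + t) = trace n (t ^ 2 + t) + (t ^ 2 + t) ^ 2 ^ n := by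
      simp [trace, Finset.sum_range_succ]
    rw [this, ih, add_pow_char_pow, ← pow_mul, ← pow_succ']
    linear_combination CharTwo.add_self_eq_zero (t ^ 2 ^ n)

/-- The trace of t² + t telescopes to t^q + t = 0. As the Artin–Schreier values have index two, a
single further element of trace 0 would make the trace vanish on both cosets. -/
theorem trace_eq_zero_iff [Fintype F] {h : ℕ} (hq : Fintype.card F = 2 ^ h) {c : F} :
    trace h c = 0 ↔ IsArtinSchreier c := by
  have key : ∀ d : F, IsArtinSchreier d → trace h d = 0 := by
    rintro _ ⟨t, rfl⟩
    rw [trace_sq_add, ← hq, FiniteField.pow_card, CharTwo.add_self_eq_zero]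
  refine ⟨fun hc => ?_, key c⟩
  by_contra hn
  obtain ⟨x, hx⟩ := exists_trace_ne_zero hq
  by_cases hxa : IsArtinSchreier x
  · exact hx (key x hxa)
  · have := key _ (isArtinSchreier_add_of_not hn hxa)
    rw [trace_add, hc, zero_add] at this
    exact hx this

theorem binForm_eq_zero {d : F} (hd : ¬ IsArtinSchreier d) {x y : F} (h : binForm d x y = 0) :
    x = 0 ∧ y = 0 := by
  have hy : y = 0 := by
    by_contra hy
    refine hd ⟨x / y, ?_⟩
    unfold binForm at h
    field_simp
    linear_combination h - d * y ^ 2 * CharTwo.two_eq_zero (R := F)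
  subst hy
  exact ⟨by simpa [binForm] using h, rfl⟩

theorem exists_binForm_eq [Finite F] (d r : F) : ∃ x, binForm d x 0 = r := by
  obtain ⟨x, hx⟩ := exists_sq_eq r
  exact ⟨x, by simp [binForm, hx]⟩

end ArtinSchreier

/-! ### Quadratic forms on a four-dimensional space. -/

section Forms

variable {F W : Type*} [Field F] [AddCommGroup W] [Module F W]

/-- No line of `PG(W)` consists of zeros of `P`. -/
def NoLine (P : QuadraticForm F W) : Prop :=
  ∀ x y : W, P x = 0 → P y = 0 → QuadraticMap.polar P x y = 0 → ¬ LinearIndependent F ![x, y]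

theorem map_lin_comb (P : QuadraticForm F W) (s t : F) (x y : W) :
    P (s • x + t • y) = s ^ 2 * P x + t ^ 2 * P y + s * t * QuadraticMap.polar P x y := by
  rw [QuadraticMap.map_add P, QuadraticMap.map_smul, QuadraticMap.map_smul,
    QuadraticMap.polar_smul_left, QuadraticMap.polar_smul_right]
  simp only [smul_eq_mul]
  ring

/-- The form `X₁X₂ + aX₃² + cX₃X₄ + dX₄²`. -/
noncomputable def ellipticForm (b : Module.Basis (Fin 4) F W) (a c d : F) : QuadraticForm F W :=
  QuadraticMap.linMulLin (b.coord 0) (b.coord 1) +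
    (a • QuadraticMap.linMulLin (b.coord 2) (b.coord 2) +
      c • QuadraticMap.linMulLin (b.coord 2) (b.coord 3) +
      d • QuadraticMap.linMulLin (b.coord 3) (b.coord 3))

theorem ellipticForm_apply (b : Module.Basis (Fin 4) F W) (a c d : F) (w : W) :
    ellipticForm b a c d w = b.repr w 0 * b.repr w 1 +
      (a * b.repr w 2 ^ 2 + c * (b.repr w 2 * b.repr w 3) + d * b.repr w 3 ^ 2) := by
  simp [ellipticForm, sq]

/-- Vectors of a four-dimensional space with prescribed coordinates. -/
noncomputable def vecOf (b : Module.Basis (Fin 4) F W) (x y z t : F) : W := b.equivFun.symm ![x, y, z, t]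

theorem ellipticForm_vecOf (b : Module.Basis (Fin 4) F W) (a c d x y z t : F) :
    ellipticForm b a c d (vecOf b x y z t) = x * y + (a * z ^ 2 + c * (z * t) + d * t ^ 2) := by
  have h : ∀ i, b.repr (vecOf b x y z t) i = ![x, y, z, t] i := fun i => by
    rw [← Module.Basis.equivFun_apply, vecOf, LinearEquiv.apply_symm_apply]
  rw [ellipticForm_apply, h, h, h, h]
  simp

theorem eq_vecOf (b : Module.Basis (Fin 4) F W) (w : W) :
    w = vecOf b (b.repr w 0) (b.repr w 1) (b.repr w 2) (b.repr w 3) := by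
  rw [vecOf, LinearEquiv.eq_symm_apply]
  ext i
  fin_cases i <;> simp

theorem vecOf_add (b : Module.Basis (Fin 4) F W) (x y z t x' y' z' t' : F) :
    vecOf b x y z t + vecOf b x' y' z' t' = vecOf b (x + x') (y + y') (z + z') (t + t') := by
  rw [vecOf, vecOf, ← map_add, vecOf]
  congr 1
  ext i
  fin_cases i <;> rfl

theorem smul_vecOf (b : Module.Basis (Fin 4) F W) (r x y z t : F) :
    r • vecOf b x y z t = vecOf b (r * x) (r * y) (r * z) (r * t) := by
  rw [vecOf, ← map_smul, vecOf]
  congr 1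
  ext i
  fin_cases i <;> rfl

theorem vecOf_zero (b : Module.Basis (Fin 4) F W) : vecOf b 0 0 0 0 = 0 := by
  rw [vecOf, LinearEquiv.symm_apply_eq, map_zero]
  ext i
  fin_cases i <;> rfl

theorem polar_ellipticForm (b : Module.Basis (Fin 4) F W) (a c d x y z t x' y' z' t' : F) :
    QuadraticMap.polar (ellipticForm b a c d) (vecOf b x y z t) (vecOf b x' y' z' t') =
      x * y' + x' * y + 2 * a * (z * z') + c * (z * t' + z' * t) + 2 * d * (t * t') := by
  rw [QuadraticMap.polar, vecOf_add]
  simp only [ellipticForm_vecOf]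
  ring

theorem exists_lin_comb_apply_eq_zero (f : W →ₗ[F] F) (x y : W) :
    ∃ s t : F, (s ≠ 0 ∨ t ≠ 0) ∧ f (s • x + t • y) = 0 := by
  by_cases hx : f x = 0
  · exact ⟨1, 0, by simp, by simp [hx]⟩
  · refine ⟨f y, - f x, Or.inr (neg_ne_zero.2 hx), ?_⟩
    simp only [map_add, map_smul, smul_eq_mul]
    ring

/-- A line of zeros would meet both hyperplanes where the first or the second coordinate vanishes.
At such points the anisotropic part must vanish, so they are the two basic singular points; but the
sum of nonzero vectors on these points is not a zero. -/
theorem noLine_ellipticForm (b : Module.Basis (Fin 4) F W) {a c d : F}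
    (hg : ∀ s t : F, a * s ^ 2 + c * (s * t) + d * t ^ 2 = 0 → s = 0 ∧ t = 0) :
    NoLine (ellipticForm b a c d) := by
  intro x y hx hy hxy hli
  rw [LinearIndependent.pair_iff] at hli
  have hz : ∀ s t : F, ellipticForm b a c d (s • x + t • y) = 0 := fun s t => by
    rw [map_lin_comb, hx, hy, hxy]; ring
  have key : ∀ i : Fin 4, ∃ s t : F, s • x + t • y ≠ 0 ∧ b.repr (s • x + t • y) i = 0 := by
    intro i
    obtain ⟨s, t, hst, h⟩ := exists_lin_comb_apply_eq_zero (b.coord i) x y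
    refine ⟨s, t, fun h0 => ?_, h⟩
    exact hst.elim (fun h => h (hli s t h0).1) (fun h => h (hli s t h0).2)
  obtain ⟨s, t, hw, h0⟩ := key 0
  obtain ⟨s', t', hw', h1⟩ := key 1
  have h2 := hz s t
  have h3 := hz s' t'
  have h4 := hz (s + s') (t + t')
  rw [show (s + s') • x + (t + t') • y = (s • x + t • y) + (s' • x + t' • y) by module] at h4
  set w := s • x + t • y
  set w' := s' • x + t' • y
  rw [ellipticForm_apply, h0, zero_mul, zero_add] at h2
  rw [ellipticForm_apply, h1, mul_zero, zero_add] at h3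
  obtain ⟨h5, h6⟩ := hg _ _ h2
  obtain ⟨h7, h8⟩ := hg _ _ h3
  rw [ellipticForm_apply] at h4
  simp only [map_add, Finsupp.add_apply, h0, h1, h5, h6, h7, h8] at h4
  have h9 : b.repr w' 0 * b.repr w 1 = 0 := by linear_combination h4
  rcases mul_eq_zero.1 h9 with h | h
  · apply hw'
    rw [eq_vecOf b w', h, h1, h7, h8, vecOf_zero]
  · apply hw
    rw [eq_vecOf b w, h, h0, h5, h6, vecOf_zero]

theorem exists_ellipticForm_zero (b : Module.Basis (Fin 4) F W) {a c d : F}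
    (f : W →ₗ[F] F) (hf : f ≠ 0) : ∃ w, ellipticForm b a c d w = 0 ∧ f w ≠ 0 := by
  by_contra! h
  apply hf
  have h0 := h (vecOf b 1 0 0 0) (by simp [ellipticForm_vecOf])
  have h1 := h (vecOf b 0 1 0 0) (by simp [ellipticForm_vecOf])
  have hw : ∀ z t, f (vecOf b 0 0 z t) = 0 := by
    intro z t
    have h2 := h (vecOf b 1 (-(a * z ^ 2 + c * (z * t) + d * t ^ 2)) z t)
      (by rw [ellipticForm_vecOf]; ring)
    have h3 : vecOf b 1 (-(a * z ^ 2 + c * (z * t) + d * t ^ 2)) z t = vecOf b 1 0 0 0 +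
      (-(a * z ^ 2 + c * (z * t) + d * t ^ 2)) • vecOf b 0 1 0 0 + vecOf b 0 0 z t := by
      simp [smul_vecOf, vecOf_add]
    rw [h3, map_add, map_add, map_smul, h0, h1] at h2
    simpa using h2
  ext w
  rw [eq_vecOf b w, show vecOf b (b.repr w 0) (b.repr w 1) (b.repr w 2) (b.repr w 3) =
    b.repr w 0 • vecOf b 1 0 0 0 + b.repr w 1 • vecOf b 0 1 0 0 +
      vecOf b 0 0 (b.repr w 2) (b.repr w 3) by simp [smul_vecOf, vecOf_add]]
  simp [h0, h1, hw]

/-- A bilinear form vanishing wherever the nondegenerate form `f` vanishes is a multiple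
of `f`. -/
theorem exists_eq_smul_of_vanishing (f g : LinearMap.BilinForm F W)
    (hfg : ∀ x y, f x y = 0 → g x y = 0) : ∃ μ : F, ∀ x y, g x y = μ * f x y := by
  by_cases hf : ∀ x y, f x y = 0
  · exact ⟨0, fun x y => by rw [hfg x y (hf x y), zero_mul]⟩
  push Not at hf
  obtain ⟨x₀, y₀, h₀⟩ := hf
  have row : ∀ x y₁, f x y₁ ≠ 0 → ∀ y, g x y * f x y₁ = g x y₁ * f x y := by
    intro x y₁ h1 y
    have := hfg x (y - (f x y / f x y₁) • y₁) (by
      rw [map_sub, map_smul, smul_eq_mul, div_mul_cancel₀ _ h1, sub_self])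
    rw [map_sub, map_smul, smul_eq_mul] at this
    field_simp at this
    linear_combination this
  have col : ∀ x, g x y₀ * f x₀ y₀ = g x₀ y₀ * f x y₀ := by
    intro x
    have := hfg (x - (f x y₀ / f x₀ y₀) • x₀) y₀ (by
      rw [map_sub, map_smul, LinearMap.sub_apply, LinearMap.smul_apply, smul_eq_mul,
        div_mul_cancel₀ _ h₀, sub_self])
    rw [map_sub, map_smul, LinearMap.sub_apply, LinearMap.smul_apply, smul_eq_mul] at this
    field_simp at this
    linear_combination this
  have main : ∀ x y, f x y₀ ≠ 0 → g x y = g x₀ y₀ / f x₀ y₀ * f x y := by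
    intro x y hx
    have h1 := row x y₀ hx y
    have h2 := col x
    rw [div_mul_eq_mul_div, eq_div_iff h₀]
    apply mul_right_cancel₀ hx
    linear_combination f x₀ y₀ * h1 + f x y * h2
  refine ⟨g x₀ y₀ / f x₀ y₀, fun x y => ?_⟩
  by_cases hx : f x y₀ = 0
  -- A row vanishing at `y₀` is the difference of the rows of `x + x₀` and `x₀`, neither of which
  -- vanishes there.
  · have h1 := main (x + x₀) y (by simpa [hx] using h₀)
    have h2 := main x₀ y h₀
    simp only [map_add, LinearMap.add_apply] at h1
    linear_combination h1 - h2
  · exact main x y hx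

variable [CharP F 2]

theorem polar_self_two (P : QuadraticForm F W) (x : W) : QuadraticMap.polar P x x = 0 := by
  rw [QuadraticMap.polar_self, two_nsmul, CharTwo.add_self_eq_zero]

/-- Without the mixed term, the form is the square of a linear form, since every element is a
square; such a form has the nontrivial zero (√d, √a) unless a = d = 0. -/
theorem coeff_ne_zero_of_anisotropic [Finite F] {a c d : F}
    (hg : ∀ s t : F, a * s ^ 2 + c * (s * t) + d * t ^ 2 = 0 → s = 0 ∧ t = 0) : c ≠ 0 := by
  rintro rfl
  obtain ⟨a, rfl⟩ := exists_sq_eq a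
  obtain ⟨d, rfl⟩ := exists_sq_eq d
  obtain ⟨h1, h2⟩ := hg d a (by linear_combination a ^ 2 * d ^ 2 * CharTwo.two_eq_zero (R := F))
  subst h1 h2
  simpa using hg 1 0 (by simp)

theorem polar_ellipticForm_nondegenerate [Finite F] (b : Module.Basis (Fin 4) F W) {a c d : F}
    (hg : ∀ s t : F, a * s ^ 2 + c * (s * t) + d * t ^ 2 = 0 → s = 0 ∧ t = 0) (w : W)
    (hw : ∀ w', QuadraticMap.polar (ellipticForm b a c d) w w' = 0) : w = 0 := by
  have hc := coeff_ne_zero_of_anisotropic hg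
  rw [eq_vecOf b w] at hw
  have h := fun x y z t => hw (vecOf b x y z t)
  simp only [polar_ellipticForm, CharTwo.two_eq_zero] at h
  have h0 := h 0 1 0 0
  have h1 := h 1 0 0 0
  have h2 := h 0 0 0 1
  have h3 := h 0 0 1 0
  simp only [hc, mul_one, zero_mul, mul_zero, one_mul, add_zero, zero_add, mul_eq_zero,
    false_or] at h0 h1 h2 h3
  rw [eq_vecOf b w, h0, h1, h2, h3, vecOf_zero]

end Forms

/-! ### Points, zero sets and tangent lines. -/

section Points

variable {F V : Type*} [Field F] [AddCommGroup V] [Module F V]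

/-- The points of `S` at which the quadratic form `P` on `S` vanishes. -/
def zeroSet (S : Submodule F V) (P : QuadraticForm F S) : Set (ℙ F V) :=
  {p | p.submodule ≤ S ∧ ∀ w : S, (w : V) ∈ p.submodule → P w = 0}

theorem mk_mem_pointsOf {L : Submodule F V} {v : V} (hv : v ≠ 0) :
    Projectivization.mk F v hv ∈ pointsOf L ↔ v ∈ L := by
  rw [pointsOf, Set.mem_ofPred_eq, Projectivization.submodule_mk,
    Submodule.span_singleton_le_iff_mem]

theorem mk_mem_quadric {Q : QuadraticForm F V} {v : V} (hv : v ≠ 0) :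
    Projectivization.mk F v hv ∈ quadric Q ↔ Q v = 0 := by
  rw [quadric, Set.mem_ofPred_eq, Projectivization.submodule_mk]
  refine ⟨fun h => h v (Submodule.mem_span_singleton_self v), fun h w hw => ?_⟩
  obtain ⟨t, rfl⟩ := Submodule.mem_span_singleton.1 hw
  rw [QuadraticMap.map_smul, h, smul_zero]

theorem mk_mem_zeroSet {S : Submodule F V} {P : QuadraticForm F S} {v : V} (hv : v ≠ 0) :
    Projectivization.mk F v hv ∈ zeroSet S P ↔ ∃ h : v ∈ S, P ⟨v, h⟩ = 0 := by
  rw [zeroSet, Set.mem_ofPred_eq, Projectivization.submodule_mk,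
    Submodule.span_singleton_le_iff_mem]
  refine ⟨fun h => ⟨h.1, h.2 ⟨v, h.1⟩ (Submodule.mem_span_singleton_self v)⟩, ?_⟩
  rintro ⟨h, h0⟩
  refine ⟨h, fun w hw => ?_⟩
  obtain ⟨t, ht⟩ := Submodule.mem_span_singleton.1 hw
  have : w = t • (⟨v, h⟩ : S) := Subtype.ext ht.symm
  rw [this, QuadraticMap.map_smul, h0, smul_zero]

/-- The restriction of a quadratic form to a subspace. -/
def restrictTo (Q : QuadraticForm F V) (S : Submodule F V) : QuadraticForm F S :=
  Q.comp S.subtype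

theorem restrictTo_apply (Q : QuadraticForm F V) (S : Submodule F V) (w : S) :
    restrictTo Q S w = Q w := rfl

theorem polar_restrictTo (Q : QuadraticForm F V) (S : Submodule F V) (x y : S) :
    QuadraticMap.polar (restrictTo Q S) x y = QuadraticMap.polar Q x y := rfl

theorem sectionOf_eq_zeroSet (Q : QuadraticForm F V) (S : Submodule F V) :
    sectionOf Q S = zeroSet S (restrictTo Q S) := by
  ext p
  induction p using Projectivization.ind with
  | h v hv =>
    rw [sectionOf, Set.mem_inter_iff, mk_mem_pointsOf, mk_mem_quadric, mk_mem_zeroSet]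
    exact ⟨fun h => ⟨h.1, h.2⟩, fun ⟨h, h'⟩ => ⟨h, h'⟩⟩

theorem zeroSet_ellipticForm (S : Submodule F V) (b : Module.Basis (Fin 4) F S) (a c d : F) :
    zeroSet S (ellipticForm b a c d) = {p | p.submodule ≤ S ∧ ∀ w : S, (w : V) ∈ p.submodule →
      b.repr w 0 * b.repr w 1 +
        (a * b.repr w 2 ^ 2 + c * (b.repr w 2 * b.repr w 3) + d * b.repr w 3 ^ 2) = 0} := by
  simp only [zeroSet, ellipticForm_apply]

theorem isEllipticQuadric_iff {S : Submodule F V} {E : Set (ℙ F V)} :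
    IsEllipticQuadric S E ↔ ∃ (b : Module.Basis (Fin 4) F S) (a c d : F),
      (∀ s t : F, a * s ^ 2 + c * (s * t) + d * t ^ 2 = 0 → s = 0 ∧ t = 0) ∧
      E = zeroSet S (ellipticForm b a c d) := by
  simp only [IsEllipticQuadric, zeroSet_ellipticForm]

theorem apply_eq_zero_iff_of_zeroSet_eq {S : Submodule F V} {P R : QuadraticForm F S}
    (h : zeroSet S P = zeroSet S R) (w : S) : P w = 0 ↔ R w = 0 := by
  by_cases hw : (w : V) = 0
  · have : w = 0 := Subtype.ext hw
    simp [this]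
  · have := Set.ext_iff.1 h (Projectivization.mk F (w : V) hw)
    rw [mk_mem_zeroSet, mk_mem_zeroSet] at this
    simpa using this

theorem zeroSet_congr {S : Submodule F V} {P R : QuadraticForm F S}
    (h : ∀ w, P w = 0 ↔ R w = 0) : zeroSet S P = zeroSet S R := by
  simp only [zeroSet, h]

theorem exists_lin_comb_of_finrank_two {L : Submodule F V} (hL : Module.finrank F L = 2) {u : V}
    (hu : u ∈ L) (hu0 : u ≠ 0) :
    ∃ r ∈ L, LinearIndependent F ![u, r] ∧ ∀ x ∈ L, ∃ s t : F, x = s • u + t • r := by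
  have : ¬ L ≤ F ∙ u := by
    intro h
    have h1 := Submodule.finrank_mono h
    rw [hL, finrank_span_singleton hu0] at h1
    omega
  obtain ⟨r, hr, hru⟩ := Set.not_subset.1 this
  have hli : LinearIndependent F ![u, r] := by
    rw [LinearIndependent.pair_iff' hu0]
    intro a ha
    exact hru (Submodule.mem_span_singleton.2 ⟨a, ha⟩)
  refine ⟨r, hr, hli, ?_⟩
  have hle : Submodule.span F {u, r} ≤ L :=
    Submodule.span_le.2 (Set.insert_subset hu (Set.singleton_subset_iff.2 hr))
  have hfin : FiniteDimensional F L := Module.finite_of_finrank_pos (by omega)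
  have heq : Submodule.span F {u, r} = L := by
    apply Submodule.eq_of_le_of_finrank_eq hle
    rw [hL]
    have := finrank_span_eq_card hli
    rwa [Matrix.range_cons_cons_empty, Fintype.card_fin] at this
  intro x hx
  rw [← heq, Submodule.mem_span_pair] at hx
  obtain ⟨s, t, h⟩ := hx
  exact ⟨s, t, h.symm⟩

theorem exists_ne_zero_of_finrank_two {L : Submodule F V} (hL : Module.finrank F L = 2) :
    ∃ u ∈ L, u ≠ 0 := by
  have : L ≠ ⊥ := by
    rintro rfl
    simp at hL
  exact Submodule.exists_mem_ne_zero_of_ne_bot this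

variable [CharP F 2]

/-- If u is the zero on L and r another vector of L with B(u,r) ≠ 0, then (P(r)/B(u,r))u + r is a
second zero. So u is orthogonal to L, and L is totally isotropic because the polar form is
alternating. -/
theorem polar_eq_zero_of_existsUnique {S : Submodule F V} {P : QuadraticForm F S}
    {L : Submodule F V} (hLS : L ≤ S) (hL : Module.finrank F L = 2)
    (h : ∃! p : ℙ F V, p ∈ pointsOf L ∩ zeroSet S P) (x y : S) (hx : (x : V) ∈ L)
    (hy : (y : V) ∈ L) : QuadraticMap.polar P x y = 0 := by
  obtain ⟨p, ⟨hpL, hpP⟩, hu⟩ := h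
  induction p using Projectivization.ind with
  | h u hu0 =>
  rw [mk_mem_pointsOf] at hpL
  rw [mk_mem_zeroSet] at hpP
  obtain ⟨huS, hPu⟩ := hpP
  obtain ⟨r, hr, hli, hspan⟩ := exists_lin_comb_of_finrank_two hL hpL hu0
  have hur : QuadraticMap.polar P ⟨u, huS⟩ ⟨r, hLS hr⟩ = 0 := by
    by_contra hne
    set t := P ⟨r, hLS hr⟩ / QuadraticMap.polar P ⟨u, huS⟩ ⟨r, hLS hr⟩
    rw [LinearIndependent.pair_iff] at hli
    have hw0 : t • u + r ≠ 0 := by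
      intro h0
      have := (hli t 1 (by rw [one_smul]; exact h0)).2
      exact one_ne_zero this
    have hw := hu (Projectivization.mk F (t • u + r) hw0) ⟨by
      rw [mk_mem_pointsOf]
      exact L.add_mem (L.smul_mem _ hpL) hr, by
      rw [mk_mem_zeroSet]
      refine ⟨S.add_mem (S.smul_mem _ huS) (hLS hr), ?_⟩
      have := map_lin_comb P t 1 ⟨u, huS⟩ ⟨r, hLS hr⟩
      rw [one_smul] at this
      refine this.trans ?_
      rw [hPu, mul_zero, zero_add, mul_one, one_pow, one_mul, div_mul_cancel₀ _ hne,
        CharTwo.add_self_eq_zero]⟩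
    rw [Projectivization.mk_eq_mk_iff'] at hw
    obtain ⟨s, hs⟩ := hw
    have := (hli (t - s) 1 (by rw [sub_smul, hs]; module)).2
    exact one_ne_zero this
  obtain ⟨s, t, hst⟩ := hspan x hx
  obtain ⟨s', t', hst'⟩ := hspan y hy
  have h1 : x = s • (⟨u, huS⟩ : S) + t • (⟨r, hLS hr⟩ : S) := Subtype.ext hst
  have h2 : y = s' • (⟨u, huS⟩ : S) + t' • (⟨r, hLS hr⟩ : S) := Subtype.ext hst'
  rw [h1, h2]
  simp only [QuadraticMap.polar_add_left, QuadraticMap.polar_add_right,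
    QuadraticMap.polar_smul_left, QuadraticMap.polar_smul_right, polar_self_two, hur,
    QuadraticMap.polar_comm P ⟨r, hLS hr⟩, smul_zero, add_zero]

/-- On an isotropic line P is additive, so βu + αr is a zero for α² = P(u) and β² = P(r). Two
distinct zeros would make the whole line singular. -/
theorem existsUnique_of_polar_eq_zero [Finite F] {S : Submodule F V} {P : QuadraticForm F S}
    (hP : NoLine P) {L : Submodule F V} (hLS : L ≤ S) (hL : Module.finrank F L = 2)
    (h : ∀ x y : S, (x : V) ∈ L → (y : V) ∈ L → QuadraticMap.polar P x y = 0) :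
    ∃! p : ℙ F V, p ∈ pointsOf L ∩ zeroSet S P := by
  obtain ⟨u, hu, hu0⟩ := exists_ne_zero_of_finrank_two hL
  obtain ⟨r, hr, hli, hspan⟩ := exists_lin_comb_of_finrank_two hL hu hu0
  have hex : ∃ (w : V) (hw : w ∈ L), w ≠ 0 ∧ P ⟨w, hLS hw⟩ = 0 := by
    obtain ⟨α, hα⟩ := exists_sq_eq (P ⟨u, hLS hu⟩)
    obtain ⟨β, hβ⟩ := exists_sq_eq (P ⟨r, hLS hr⟩)
    by_cases hα0 : α = 0
    · exact ⟨u, hu, hu0, by rw [← hα, hα0]; ring⟩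
    · refine ⟨β • u + α • r, L.add_mem (L.smul_mem _ hu) (L.smul_mem _ hr), fun h0 => ?_, ?_⟩
      · exact hα0 (LinearIndependent.pair_iff.1 hli β α h0).2
      · refine (map_lin_comb P β α ⟨u, hLS hu⟩ ⟨r, hLS hr⟩).trans ?_
        rw [h ⟨u, hLS hu⟩ ⟨r, hLS hr⟩ hu hr, ← hα, ← hβ]
        linear_combination α ^ 2 * β ^ 2 * CharTwo.two_eq_zero (R := F)
  obtain ⟨w, hw, hw0, hPw⟩ := hex
  refine ⟨Projectivization.mk F w hw0, ⟨(mk_mem_pointsOf hw0).2 hw,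
    (mk_mem_zeroSet hw0).2 ⟨hLS hw, hPw⟩⟩, ?_⟩
  rintro p ⟨hpL, hpP⟩
  induction p using Projectivization.ind with
  | h v hv =>
  rw [mk_mem_pointsOf] at hpL
  rw [mk_mem_zeroSet] at hpP
  obtain ⟨hvS, hPv⟩ := hpP
  have hn := hP ⟨w, hLS hw⟩ ⟨v, hvS⟩ hPw hPv (h _ _ hw hpL)
  rw [LinearIndependent.pair_iff' (by simpa using hw0)] at hn
  push Not at hn
  obtain ⟨s, hs⟩ := hn
  rw [Projectivization.mk_eq_mk_iff']
  exact ⟨s, congrArg Subtype.val hs⟩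

theorem isTangentLine_iff [Finite F] {Q : QuadraticForm F V} {S : Submodule F V}
    (hQ : NoLine (restrictTo Q S)) {L : Submodule F V} :
    IsTangentLine Q S L ↔ L ≤ S ∧ Module.finrank F L = 2 ∧
      ∀ x ∈ L, ∀ y ∈ L, QuadraticMap.polar Q x y = 0 := by
  rw [IsTangentLine, sectionOf_eq_zeroSet]
  refine and_congr_right fun hLS => and_congr_right fun hL => ⟨fun h x hx y hy => ?_, fun h => ?_⟩
  · exact polar_eq_zero_of_existsUnique hLS hL h ⟨x, hLS hx⟩ ⟨y, hLS hy⟩ hx hy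
  · exact existsUnique_of_polar_eq_zero hQ hLS hL fun x y hx hy => h x hx y hy

end Points

/-! ### Elliptic sections and the equations of classical ovoids. -/

section Section

variable {F V : Type*} [Field F] [AddCommGroup V] [Module F V]

/-- The properties of the restriction of `Q` to a solid `S` meeting the quadric `Q = 0` in an
elliptic quadric. -/
structure IsEllipticSection (Q : QuadraticForm F V) (S : Submodule F V) : Prop where
  noLine : NoLine (restrictTo Q S)
  nondegenerate : ∀ x ∈ S, (∀ y ∈ S, QuadraticMap.polar Q x y = 0) → x = 0
  exists_zero : ∀ a ∈ S, a ≠ 0 → ∃ b ∈ S, Q b = 0 ∧ QuadraticMap.polar Q a b = 1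
  finrank_eq : Module.finrank F S = 4

theorem NoLine.congr {W : Type*} [AddCommGroup W] [Module F W] {P R : QuadraticForm F W}
    (hP : NoLine P) (h : ∀ w, R w = 0 ↔ P w = 0) : NoLine R := by
  intro x y hx hy hxy
  refine hP x y ((h x).1 hx) ((h y).1 hy) ?_
  have h3 : R (x + y) = 0 := by rw [QuadraticMap.map_add R, hx, hy, hxy]; simp
  rw [QuadraticMap.polar, (h _).1 hx, (h _).1 hy, (h _).1 h3]
  simp

/-- The form `Q + B(·, a)²`, where `B` is the polar form of `Q`, restricted to `S`. -/
def shiftedForm (Q : QuadraticForm F V) (S : Submodule F V) (a : V) : QuadraticForm F S :=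
  restrictTo Q S + QuadraticMap.linMulLin ((QuadraticMap.polarBilin Q a).comp S.subtype)
    ((QuadraticMap.polarBilin Q a).comp S.subtype)

theorem shiftedForm_apply (Q : QuadraticForm F V) (S : Submodule F V) (a : V) (w : S) :
    shiftedForm Q S a w = Q w + QuadraticMap.polar Q a w ^ 2 := by
  simp [shiftedForm, restrictTo, sq]

theorem finrank_map_span_pair {S : Submodule F V} {x y : S} (h : LinearIndependent F ![x, y]) :
    Module.finrank F (Submodule.span F {(x : V), (y : V)}) = 2 := by
  have h1 : LinearIndependent F ![(x : V), (y : V)] := by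
    rw [LinearIndependent.pair_iff] at h ⊢
    intro s t hst
    exact h s t (Subtype.ext hst)
  have := finrank_span_eq_card h1
  rwa [Matrix.range_cons_cons_empty, Fintype.card_fin] at this

theorem IsEllipticSection.exists_polar_eq {Q : QuadraticForm F V} {S : Submodule F V}
    (hS : IsEllipticSection Q S) (f : S →ₗ[F] F) :
    ∃ a ∈ S, ∀ w : S, f w = QuadraticMap.polar Q a w := by
  have hfin : FiniteDimensional F S :=
    Module.finite_of_finrank_pos (by rw [hS.finrank_eq]; norm_num)
  have hinj : Function.Injective (QuadraticMap.polarBilin (restrictTo Q S)) := by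
    rw [injective_iff_map_eq_zero]
    intro x hx
    exact Subtype.ext (hS.nondegenerate x x.2 fun y hy => LinearMap.congr_fun hx ⟨y, hy⟩)
  have hsurj := (LinearMap.injective_iff_surjective_of_finrank_eq_finrank
    (Subspace.dual_finrank_eq (K := F) (V := S)).symm).1 hinj
  obtain ⟨a, ha⟩ := hsurj f
  exact ⟨a, a.2, fun w => (LinearMap.congr_fun ha w).symm⟩

variable [CharP F 2]

theorem polar_eq_zero_of_forall_line {S : Submodule F V} {P R : QuadraticForm F S}
    (h : ∀ L ≤ S, Module.finrank F L = 2 →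
      (∀ x y : S, (x : V) ∈ L → (y : V) ∈ L → QuadraticMap.polar P x y = 0) →
      ∃! p : ℙ F V, p ∈ pointsOf L ∩ zeroSet S R)
    (x y : S) (hxy : QuadraticMap.polar P x y = 0) : QuadraticMap.polar R x y = 0 := by
  by_cases hli : LinearIndependent F ![x, y]
  · have hLS : Submodule.span F {(x : V), (y : V)} ≤ S :=
      Submodule.span_le.2 (Set.insert_subset x.2 (Set.singleton_subset_iff.2 y.2))
    have hx : (x : V) ∈ Submodule.span F {(x : V), (y : V)} := Submodule.subset_span (by simp)
    have hy : (y : V) ∈ Submodule.span F {(x : V), (y : V)} := Submodule.subset_span (by simp)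
    refine polar_eq_zero_of_existsUnique hLS (finrank_map_span_pair hli)
      (h _ hLS (finrank_map_span_pair hli) ?_) x y hx hy
    intro u v hu hv
    obtain ⟨s, t, hst⟩ := Submodule.mem_span_pair.1 hu
    obtain ⟨s', t', hst'⟩ := Submodule.mem_span_pair.1 hv
    rw [show u = s • x + t • y from Subtype.ext hst.symm,
      show v = s' • x + t' • y from Subtype.ext hst'.symm]
    simp only [QuadraticMap.polar_add_left, QuadraticMap.polar_add_right,
      QuadraticMap.polar_smul_left, QuadraticMap.polar_smul_right, polar_self_two, hxy,
      QuadraticMap.polar_comm P y x, smul_zero, add_zero]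
  · by_cases hx : x = 0
    · simp [hx]
    · rw [LinearIndependent.pair_iff' hx] at hli
      push Not at hli
      obtain ⟨s, rfl⟩ := hli
      rw [QuadraticMap.polar_smul_right, polar_self_two, smul_zero]

/-- This serves twice: to compare `Q` on `S` with a standard elliptic equation of its zero set, and
to compare the equation of an ovoid with `Q`. -/
theorem exists_polar_eq_mul {S : Submodule F V} {P R : QuadraticForm F S}
    (h : ∀ L ≤ S, Module.finrank F L = 2 →
      (∀ x y : S, (x : V) ∈ L → (y : V) ∈ L → QuadraticMap.polar P x y = 0) →
      ∃! p : ℙ F V, p ∈ pointsOf L ∩ zeroSet S R) :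
    ∃ μ : F, ∀ x y, QuadraticMap.polar R x y = μ * QuadraticMap.polar P x y := by
  obtain ⟨μ, hμ⟩ := exists_eq_smul_of_vanishing (QuadraticMap.polarBilin P)
    (QuadraticMap.polarBilin R) (polar_eq_zero_of_forall_line h)
  exact ⟨μ, hμ⟩

variable [Finite F]

/-- The hypothesis concerns only the zero set of `Q` on `S`. Nondegeneracy is transferred from the
standard equation through proportionality of polar forms; the factor is nonzero because the sum of
the first two basis vectors is not a zero although both summands are. -/
theorem isEllipticSection_of_isEllipticQuadric {Q : QuadraticForm F V} {S : Submodule F V}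
    (hS : IsEllipticQuadric S (sectionOf Q S)) : IsEllipticSection Q S := by
  obtain ⟨b, a, c, d, hg, hE⟩ := isEllipticQuadric_iff.1 hS
  rw [sectionOf_eq_zeroSet] at hE
  have hz := apply_eq_zero_iff_of_zeroSet_eq hE
  set P := ellipticForm b a c d with hPdef
  obtain ⟨μ, hμ⟩ := exists_polar_eq_mul (P := P) (R := restrictTo Q S) (by
    intro L hLS hL h
    rw [hE]
    exact existsUnique_of_polar_eq_zero (noLine_ellipticForm b hg) hLS hL h)
  have hμ0 : μ ≠ 0 := by
    rintro rfl
    have e0 : restrictTo Q S (vecOf b 1 0 0 0) = 0 := by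
      rw [hz, hPdef, ellipticForm_vecOf]; ring
    have e1 : restrictTo Q S (vecOf b 0 1 0 0) = 0 := by
      rw [hz, hPdef, ellipticForm_vecOf]; ring
    have e2 : restrictTo Q S (vecOf b 1 0 0 0 + vecOf b 0 1 0 0) = 0 := by
      rw [QuadraticMap.map_add (restrictTo Q S), e0, e1, hμ]; ring
    rw [hz, hPdef, vecOf_add, ellipticForm_vecOf] at e2
    simp at e2
  have hnd : ∀ x : S, (∀ y : S, QuadraticMap.polar Q x y = 0) → x = 0 := by
    intro x hx
    apply polar_ellipticForm_nondegenerate b hg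
    intro y
    have := hx y
    rw [← polar_restrictTo, hμ] at this
    exact (mul_eq_zero.1 this).resolve_left hμ0
  refine ⟨(noLine_ellipticForm b hg).congr hz, ?_, ?_, ?_⟩
  · intro x hx h
    exact congrArg Subtype.val (hnd ⟨x, hx⟩ fun y => h y y.2)
  · intro x hx hx0
    obtain ⟨w, hw, hfw⟩ := exists_ellipticForm_zero b (a := a) (c := c) (d := d)
      ((QuadraticMap.polarBilin Q x).comp S.subtype) (by
        intro h0
        apply hx0
        exact congrArg Subtype.val (hnd ⟨x, hx⟩ fun y => LinearMap.congr_fun h0 y))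
    change QuadraticMap.polar Q x w ≠ 0 at hfw
    have hQw : Q w = 0 := (hz w).2 hw
    refine ⟨(QuadraticMap.polar Q x w)⁻¹ • (w : V), S.smul_mem _ w.2, ?_, ?_⟩
    · rw [QuadraticMap.map_smul, hQw, smul_zero]
    · rw [QuadraticMap.polar_smul_right, smul_eq_mul, inv_mul_cancel₀ hfw]
  · rw [Module.finrank_eq_card_basis b, Fintype.card_fin]

/-- A quadratic form whose polar form vanishes is the square of a linear form. -/
theorem exists_linear_sq_eq {W : Type*} [AddCommGroup W] [Module F W] (D : QuadraticForm F W)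
    (hD : ∀ x y, QuadraticMap.polar D x y = 0) : ∃ f : W →ₗ[F] F, ∀ w, f w ^ 2 = D w := by
  choose f hf using fun w => exists_sq_eq (D w)
  refine ⟨{ toFun := f, map_add' := fun x y => ?_, map_smul' := fun s x => ?_ }, hf⟩
  · apply sq_inj_two
    rw [CharTwo.add_sq, hf, hf, hf, QuadraticMap.map_add D, hD, add_zero]
  · apply sq_inj_two
    rw [hf, QuadraticMap.map_smul, RingHom.id_apply, smul_eq_mul, smul_eq_mul, mul_pow, hf]
    ring

/-- Scaling the equation of the ovoid makes its polar form equal to that of `Q`. The sum of the two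
forms is then the square of a linear form, which nondegeneracy represents by a vector `a` of `S`. -/
theorem exists_zeroSet_shiftedForm {Q : QuadraticForm F V} {S : Submodule F V}
    (hS : IsEllipticSection Q S) {O : Set (ℙ F V)} (hO : IsOvoid Q S O)
    (hE : IsEllipticQuadric S O) :
    ∃ a ∈ S, O = zeroSet S (shiftedForm Q S a) ∧ NoLine (shiftedForm Q S a) := by
  obtain ⟨b, α, c, d, hg, rfl⟩ := isEllipticQuadric_iff.1 hE
  set P := ellipticForm b α c d with hPdef
  obtain ⟨μ, hμ⟩ := exists_polar_eq_mul (P := restrictTo Q S) (R := P) (by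
    intro L hLS hL h
    exact hO.2 L ((isTangentLine_iff hS.noLine).2
      ⟨hLS, hL, fun x hx y hy => h ⟨x, hLS hx⟩ ⟨y, hLS hy⟩ hx hy⟩))
  have hμ0 : μ ≠ 0 := by
    rintro rfl
    have := hμ (vecOf b 1 0 0 0) (vecOf b 0 1 0 0)
    rw [hPdef, polar_ellipticForm] at this
    simp at this
  obtain ⟨f, hf⟩ := exists_linear_sq_eq (μ⁻¹ • P + restrictTo Q S) (by
    intro x y
    rw [FunLike.coe_add, QuadraticMap.polar_add, FunLike.coe_smul,
      QuadraticMap.polar_smul, hμ, smul_eq_mul, inv_mul_cancel_left₀ hμ0,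
      CharTwo.add_self_eq_zero])
  obtain ⟨a, ha, hfa⟩ := hS.exists_polar_eq f
  have hP : ∀ w, shiftedForm Q S a w = μ⁻¹ * P w := by
    intro w
    rw [shiftedForm_apply, ← hfa, hf, add_apply, smul_apply,
      restrictTo_apply, smul_eq_mul]
    linear_combination CharTwo.add_self_eq_zero (Q w)
  have hz : ∀ w, shiftedForm Q S a w = 0 ↔ P w = 0 := by
    intro w
    rw [hP, mul_eq_zero, or_iff_right (inv_ne_zero hμ0)]
  exact ⟨a, ha, zeroSet_congr fun w => (hz w).symm, (noLine_ellipticForm b hg).congr hz⟩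

end Section

/-! ### Orthogonal decompositions and adapted bases. -/

section Adapted

variable {F V : Type*} [Field F] [AddCommGroup V] [Module F V]

/-- Three mutually orthogonal hyperbolic pairs for the polar form of `Q`. -/
structure IsSymplecticFamily (Q : QuadraticForm F V) (e : Fin 6 → V) : Prop where
  p01 : QuadraticMap.polar Q (e 0) (e 1) = 1
  p23 : QuadraticMap.polar Q (e 2) (e 3) = 1
  p45 : QuadraticMap.polar Q (e 4) (e 5) = 1
  p02 : QuadraticMap.polar Q (e 0) (e 2) = 0
  p03 : QuadraticMap.polar Q (e 0) (e 3) = 0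
  p04 : QuadraticMap.polar Q (e 0) (e 4) = 0
  p05 : QuadraticMap.polar Q (e 0) (e 5) = 0
  p12 : QuadraticMap.polar Q (e 1) (e 2) = 0
  p13 : QuadraticMap.polar Q (e 1) (e 3) = 0
  p14 : QuadraticMap.polar Q (e 1) (e 4) = 0
  p15 : QuadraticMap.polar Q (e 1) (e 5) = 0
  p24 : QuadraticMap.polar Q (e 2) (e 4) = 0
  p25 : QuadraticMap.polar Q (e 2) (e 5) = 0
  p34 : QuadraticMap.polar Q (e 3) (e 4) = 0
  p35 : QuadraticMap.polar Q (e 3) (e 5) = 0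

/-- The basis `e` is adapted to the solid `S`, its vector `a` and the scalar `δ`. -/
structure IsAdapted (Q : QuadraticForm F V) (S : Submodule F V) (a : V) (δ : F)
    (e : Module.Basis (Fin 6) F V) : Prop where
  zero_eq : e 0 = a
  apply_eq : ∀ v, Q v = Q a * e.repr v 0 ^ 2 + e.repr v 0 * e.repr v 1 +
    binForm δ (e.repr v 2) (e.repr v 3) + binForm δ (e.repr v 4) (e.repr v 5)
  mem_iff : ∀ v, v ∈ S ↔ e.repr v 4 = 0 ∧ e.repr v 5 = 0

/-- The properties of a hyperbolic form that are used below. -/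
structure IsHyperbolicSpace (Q : QuadraticForm F V) : Prop where
  finrank_eq : Module.finrank F V = 6
  nondegenerate : ∀ x, (∀ y, QuadraticMap.polar Q x y = 0) → x = 0
  exists_plane : ∃ W : Submodule F V, Module.finrank F W = 3 ∧ ∀ w ∈ W, Q w = 0

theorem polar_of_hyperbolic {Q : QuadraticForm F V} {b : Module.Basis (Fin 6) F V}
    (hb : ∀ v, Q v = b.repr v 0 * b.repr v 1 + b.repr v 2 * b.repr v 3 + b.repr v 4 * b.repr v 5)
    (v w : V) : QuadraticMap.polar Q v w = b.repr v 0 * b.repr w 1 + b.repr w 0 * b.repr v 1 +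
      b.repr v 2 * b.repr w 3 + b.repr w 2 * b.repr v 3 + b.repr v 4 * b.repr w 5 +
      b.repr w 4 * b.repr v 5 := by
  rw [QuadraticMap.polar, hb, hb, hb]
  simp only [map_add, Finsupp.add_apply]
  ring

theorem IsHyperbolic.isHyperbolicSpace {Q : QuadraticForm F V} (hQ : IsHyperbolic Q) :
    IsHyperbolicSpace Q := by
  obtain ⟨b, hb⟩ := hQ
  have hp := polar_of_hyperbolic hb
  refine ⟨by rw [Module.finrank_eq_card_basis b, Fintype.card_fin], fun x hx => ?_, ?_⟩
  · apply b.ext_elem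
    intro i
    have h := fun j => hx (b j)
    simp only [hp, Module.Basis.repr_self, Finsupp.single_apply] at h
    have h0 := h 0
    have h1 := h 1
    have h2 := h 2
    have h3 := h 3
    have h4 := h 4
    have h5 := h 5
    simp at h0 h1 h2 h3 h4 h5
    fin_cases i <;> simp [*]
  · have hli : LinearIndependent F (b ∘ ![0, 2, 4]) :=
      b.linearIndependent.comp _ (by decide)
    refine ⟨Submodule.span F (Set.range (b ∘ ![0, 2, 4])), ?_, ?_⟩
    · rw [finrank_span_eq_card hli, Fintype.card_fin]
    · have : Submodule.span F (Set.range (b ∘ ![0, 2, 4])) ≤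
          LinearMap.ker (b.coord 1) ⊓ LinearMap.ker (b.coord 3) ⊓ LinearMap.ker (b.coord 5) := by
        rw [Submodule.span_le]
        rintro _ ⟨i, rfl⟩
        fin_cases i <;> simp
      intro w hw
      obtain ⟨⟨h1, h3⟩, h5⟩ := this hw
      simp only [SetLike.mem_coe, LinearMap.mem_ker, Module.Basis.coord_apply] at h1 h3 h5
      rw [hb, h1, h3, h5]
      ring

theorem IsSymplecticFamily.apply_eq {Q : QuadraticForm F V} {e : Module.Basis (Fin 6) F V}
    (h : IsSymplecticFamily Q e) (v : V) :
    Q v = e.repr v 0 ^ 2 * Q (e 0) + e.repr v 1 ^ 2 * Q (e 1) + e.repr v 2 ^ 2 * Q (e 2) +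
      e.repr v 3 ^ 2 * Q (e 3) + e.repr v 4 ^ 2 * Q (e 4) + e.repr v 5 ^ 2 * Q (e 5) +
      e.repr v 0 * e.repr v 1 + e.repr v 2 * e.repr v 3 + e.repr v 4 * e.repr v 5 := by
  conv_lhs => rw [← e.sum_repr v, Fin.sum_univ_six]
  simp only [QuadraticMap.map_add Q, QuadraticMap.polar_add_left, QuadraticMap.polar_smul_left,
    QuadraticMap.polar_smul_right, QuadraticMap.map_smul, h.p01, h.p23, h.p45, h.p02, h.p03,
    h.p04, h.p05, h.p12, h.p13, h.p14, h.p15, h.p24, h.p25, h.p34, h.p35, smul_eq_mul]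
  ring

theorem mem_polar_iff {Q : QuadraticForm F V} {T : Submodule F V} {v : V} :
    v ∈ polar Q T ↔ ∀ w ∈ T, QuadraticMap.polar Q w v = 0 := Iff.rfl

theorem isSymplecticFamily_of_pairs {Q : QuadraticForm F V} {S : Submodule F V} {a b x y m n : V}
    (ha : a ∈ S) (hb : b ∈ S) (hx : x ∈ S) (hy : y ∈ S) (hm : m ∈ polar Q S)
    (hn : n ∈ polar Q S) (hab : QuadraticMap.polar Q a b = 1) (hxy : QuadraticMap.polar Q x y = 1)
    (hmn : QuadraticMap.polar Q m n = 1) (hax : QuadraticMap.polar Q a x = 0) (hbx :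
        QuadraticMap.polar Q b x = 0)
    (hay : QuadraticMap.polar Q a y = 0) (hby : QuadraticMap.polar Q b y = 0) :
    IsSymplecticFamily Q ![a, b, x, y, m, n] :=
  ⟨hab, hxy, hmn, hax, hay, hm a ha, hn a ha, hbx, hby, hm b hb, hn b hb, hm x hx, hn x hx,
    hm y hy, hn y hy⟩

theorem IsEllipticSection.exists_ne_zero_mem {Q : QuadraticForm F V} {S : Submodule F V}
    (hS : IsEllipticSection Q S) : ∃ a ∈ S, a ≠ 0 := by
  have : S ≠ ⊥ := by
    rintro rfl
    have := hS.finrank_eq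
    simp at this
  exact Submodule.exists_mem_ne_zero_of_ne_bot this

theorem IsEllipticSection.eq_zero_of_orthogonal {Q : QuadraticForm F V} {S : Submodule F V}
    (hS : IsEllipticSection Q S) {a b v : V} (hb : b ∈ S) (hab : QuadraticMap.polar Q a b = 1)
    (hQb : Q b = 0) (hv : v ∈ S) (hav : QuadraticMap.polar Q a v = 0) (hbv : QuadraticMap.polar Q b
        v = 0)
    (hQv : Q v = 0) : v = 0 := by
  have hb0 : (⟨b, hb⟩ : S) ≠ 0 := by
    intro h
    rw [show b = 0 from congrArg Subtype.val h, QuadraticMap.polar_zero_right] at hab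
    exact zero_ne_one hab
  have hdep := hS.noLine ⟨b, hb⟩ ⟨v, hv⟩ hQb hQv hbv
  rw [LinearIndependent.pair_iff' hb0] at hdep
  push Not at hdep
  obtain ⟨s, hs⟩ := hdep
  have hs' : s • b = v := congrArg Subtype.val hs
  rw [← hs', QuadraticMap.polar_smul_right, hab, smul_eq_mul, mul_one] at hav
  rw [← hs', hav, zero_smul]

theorem IsEllipticSection.exists_orthogonal_sub {Q : QuadraticForm F V} {S : Submodule F V}
    (hS : IsEllipticSection Q S) (v : V) : ∃ s ∈ S, v - s ∈ polar Q S := by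
  obtain ⟨s, hs, h⟩ := hS.exists_polar_eq ((QuadraticMap.polarBilin Q v).comp S.subtype)
  refine ⟨s, hs, mem_polar_iff.2 fun w hw => ?_⟩
  have h1 : QuadraticMap.polar Q v w = QuadraticMap.polar Q s w := h ⟨w, hw⟩
  rw [QuadraticMap.polar_sub_right, QuadraticMap.polar_comm, h1, QuadraticMap.polar_comm, sub_self]

theorem exists_polar_eq_one_of_orthogonal {Q : QuadraticForm F V} (hQ : IsHyperbolicSpace Q)
    {S : Submodule F V} (hS : IsEllipticSection Q S) {m : V} (hm : m ∈ polar Q S)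
    (hm0 : m ≠ 0) : ∃ n ∈ polar Q S, QuadraticMap.polar Q m n = 1 := by
  have : ∃ y, QuadraticMap.polar Q m y ≠ 0 := by
    by_contra! h
    exact hm0 (hQ.nondegenerate m h)
  obtain ⟨y, hy⟩ := this
  obtain ⟨s, hs, hys⟩ := hS.exists_orthogonal_sub y
  refine ⟨(QuadraticMap.polar Q m y)⁻¹ • (y - s), Submodule.smul_mem _ _ hys, ?_⟩
  rw [QuadraticMap.polar_smul_right, QuadraticMap.polar_sub_right, QuadraticMap.polar_comm Q m s,
    mem_polar_iff.1 hm s hs, sub_zero, smul_eq_mul, inv_mul_cancel₀ hy]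

variable [CharP F 2]

theorem IsSymplecticFamily.exists_basis {Q : QuadraticForm F V} {e : Fin 6 → V}
    (h : IsSymplecticFamily Q e) (hV : Module.finrank F V = 6) :
    ∃ b : Module.Basis (Fin 6) F V, ⇑b = e := by
  have hli : LinearIndependent F e := by
    rw [Fintype.linearIndependent_iff]
    intro g hg i
    rw [Fin.sum_univ_six] at hg
    have key := fun w => congrArg (fun v => QuadraticMap.polar Q v w) hg
    simp only [QuadraticMap.polar_add_left, QuadraticMap.polar_smul_left,
      QuadraticMap.polar_zero_left, smul_eq_mul] at key
    have h0 := key (e 0)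
    have h1 := key (e 1)
    have h2 := key (e 2)
    have h3 := key (e 3)
    have h4 := key (e 4)
    have h5 := key (e 5)
    simp only [polar_self_two, h.p01, h.p23, h.p45, h.p02, h.p03, h.p04, h.p05, h.p12, h.p13,
      h.p14, h.p15, h.p24, h.p25, h.p34, h.p35, QuadraticMap.polar_comm Q (e 1) (e 0),
      QuadraticMap.polar_comm Q (e 2) (e 0), QuadraticMap.polar_comm Q (e 2) (e 1),
      QuadraticMap.polar_comm Q (e 3) (e 0), QuadraticMap.polar_comm Q (e 3) (e 1),
      QuadraticMap.polar_comm Q (e 3) (e 2), QuadraticMap.polar_comm Q (e 4) (e 0),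
      QuadraticMap.polar_comm Q (e 4) (e 1), QuadraticMap.polar_comm Q (e 4) (e 2),
      QuadraticMap.polar_comm Q (e 4) (e 3), QuadraticMap.polar_comm Q (e 5) (e 0),
      QuadraticMap.polar_comm Q (e 5) (e 1), QuadraticMap.polar_comm Q (e 5) (e 2),
      QuadraticMap.polar_comm Q (e 5) (e 3), QuadraticMap.polar_comm Q (e 5) (e 4),
      mul_zero, mul_one, zero_add, add_zero] at h0 h1 h2 h3 h4 h5
    fin_cases i <;> assumption
  exact ⟨basisOfLinearIndependentOfCardEqFinrank hli (by rw [hV, Fintype.card_fin]),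
    coe_basisOfLinearIndependentOfCardEqFinrank _ _⟩

theorem IsSymplecticFamily.polar_four {Q : QuadraticForm F V} {e : Module.Basis (Fin 6) F V}
    (h : IsSymplecticFamily Q e) (v : V) : QuadraticMap.polar Q v (e 4) = e.repr v 5 := by
  conv_lhs => rw [← e.sum_repr v, Fin.sum_univ_six]
  simp only [QuadraticMap.polar_add_left, QuadraticMap.polar_smul_left, polar_self_two,
    QuadraticMap.polar_comm Q (e 5) (e 4), h.p04, h.p14, h.p24, h.p34, h.p45, smul_eq_mul]
  ring

theorem IsSymplecticFamily.polar_five {Q : QuadraticForm F V} {e : Module.Basis (Fin 6) F V}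
    (h : IsSymplecticFamily Q e) (v : V) : QuadraticMap.polar Q v (e 5) = e.repr v 4 := by
  conv_lhs => rw [← e.sum_repr v, Fin.sum_univ_six]
  simp only [QuadraticMap.polar_add_left, QuadraticMap.polar_smul_left, polar_self_two,
    h.p05, h.p15, h.p25, h.p35, h.p45, smul_eq_mul]
  ring

theorem IsSymplecticFamily.mem_iff {Q : QuadraticForm F V} {e : Module.Basis (Fin 6) F V}
    (h : IsSymplecticFamily Q e) {S : Submodule F V} (h0 : e 0 ∈ S) (h1 : e 1 ∈ S)
    (h2 : e 2 ∈ S) (h3 : e 3 ∈ S) (h4 : ∀ s ∈ S, QuadraticMap.polar Q s (e 4) = 0)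
    (h5 : ∀ s ∈ S, QuadraticMap.polar Q s (e 5) = 0) (v : V) :
    v ∈ S ↔ e.repr v 4 = 0 ∧ e.repr v 5 = 0 := by
  refine ⟨fun hv => ⟨?_, ?_⟩, fun ⟨hv4, hv5⟩ => ?_⟩
  · rw [← h.polar_five, h5 v hv]
  · rw [← h.polar_four, h4 v hv]
  · rw [← e.sum_repr v, Fin.sum_univ_six, hv4, hv5, zero_smul, zero_smul, add_zero, add_zero]
    exact S.add_mem (S.add_mem (S.add_mem (S.smul_mem _ h0) (S.smul_mem _ h1))
      (S.smul_mem _ h2)) (S.smul_mem _ h3)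

/-- An anisotropic plane has a basis in which the form is `x² + xy + δy²`. -/
theorem exists_normal_pair [Finite F] {Q : QuadraticForm F V} {T : Submodule F V}
    (hT : ∀ v ∈ T, Q v = 0 → v = 0) {x y : V} (hx : x ∈ T) (hy : y ∈ T) (hxy : QuadraticMap.polar Q
        x y = 1)
    {δ : F} (hδ : ¬ IsArtinSchreier δ) :
    ∃ m ∈ T, ∃ n ∈ T, Q m = 1 ∧ QuadraticMap.polar Q m n = 1 ∧ Q n = δ := by
  have hx0 : Q x ≠ 0 := by
    intro h
    rw [hT x hx h, QuadraticMap.polar_zero_left] at hxy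
    exact zero_ne_one hxy
  obtain ⟨r, hr⟩ := exists_sq_eq (Q x)⁻¹
  have hr0 : r ≠ 0 := by
    rintro rfl
    exact inv_ne_zero hx0 (by rw [← hr]; ring)
  have hm : Q (r • x) = 1 := by
    rw [QuadraticMap.map_smul, ← sq, hr, smul_eq_mul, inv_mul_cancel₀ hx0]
  have hmn : QuadraticMap.polar Q (r • x) (r⁻¹ • y) = 1 := by
    rw [QuadraticMap.polar_smul_left, QuadraticMap.polar_smul_right, hxy, smul_eq_mul,
      smul_eq_mul, mul_one, mul_inv_cancel₀ hr0]
  have hcomb : ∀ t : F, Q (r⁻¹ • y + t • r • x) = Q (r⁻¹ • y) + (t ^ 2 + t) := by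
    intro t
    rw [QuadraticMap.map_add Q, QuadraticMap.polar_smul_right, QuadraticMap.polar_comm, hmn,
      QuadraticMap.map_smul Q t, hm, smul_eq_mul, smul_eq_mul]
    ring
  have hmT : r • x ∈ T := T.smul_mem _ hx
  have hnT : ∀ t : F, r⁻¹ • y + t • r • x ∈ T := fun t =>
    T.add_mem (T.smul_mem _ hy) (T.smul_mem _ hmT)
  have hpol : ∀ t : F, QuadraticMap.polar Q (r • x) (r⁻¹ • y + t • r • x) = 1 := by
    intro t
    rw [QuadraticMap.polar_add_right, hmn, QuadraticMap.polar_smul_right, polar_self_two,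
      smul_zero, add_zero]
  have hn : ¬ IsArtinSchreier (Q (r⁻¹ • y)) := by
    rintro ⟨t, ht⟩
    have h0 := hT _ (hnT t) (by rw [hcomb, ht, CharTwo.add_self_eq_zero])
    have h1 := hpol t
    rw [h0, QuadraticMap.polar_zero_right] at h1
    exact zero_ne_one h1
  -- Adding t times the first vector changes the value at the second by t² + t, and two values
  -- outside the index-two subgroup differ by such an element.
  obtain ⟨t, ht⟩ := isArtinSchreier_add_of_not hn hδ
  refine ⟨r • x, hmT, r⁻¹ • y + t • r • x, hnT t, hm, hpol t, ?_⟩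
  rw [hcomb, ht, ← add_assoc, CharTwo.add_self_eq_zero, zero_add]

/-- Vectors of `S` are projected along ⟨a, b⟩. As dim S = 4, some projection is nonzero, and its
partner under the polar form can itself be projected without changing their product. -/
theorem exists_pair_orthogonal {Q : QuadraticForm F V} {S : Submodule F V}
    (hS : IsEllipticSection Q S) {a b : V} (ha : a ∈ S) (hb : b ∈ S) (hab : QuadraticMap.polar Q a
        b = 1) :
    ∃ x ∈ S, ∃ y ∈ S, QuadraticMap.polar Q a x = 0 ∧ QuadraticMap.polar Q b x = 0 ∧
        QuadraticMap.polar Q a y = 0 ∧ QuadraticMap.polar Q b y = 0 ∧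
      QuadraticMap.polar Q x y = 1 := by
  have hproj : ∀ v ∈ S, v - (QuadraticMap.polar Q b v • a + QuadraticMap.polar Q a v • b) ∈ S ∧
      QuadraticMap.polar Q a (v - (QuadraticMap.polar Q b v • a + QuadraticMap.polar Q a v • b)) =
          0 ∧
      QuadraticMap.polar Q b (v - (QuadraticMap.polar Q b v • a + QuadraticMap.polar Q a v • b)) =
          0 := by
    intro v hv
    refine ⟨S.sub_mem hv (S.add_mem (S.smul_mem _ ha) (S.smul_mem _ hb)), ?_, ?_⟩
    · simp only [QuadraticMap.polar_sub_right, QuadraticMap.polar_add_right,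
        QuadraticMap.polar_smul_right, polar_self_two, hab, smul_eq_mul]
      ring
    · simp only [QuadraticMap.polar_sub_right, QuadraticMap.polar_add_right,
        QuadraticMap.polar_smul_right, polar_self_two, QuadraticMap.polar_comm Q b a, hab,
        smul_eq_mul]
      ring
  have : ¬ S ≤ Submodule.span F {a, b} := by
    intro h
    have hfin := FiniteDimensional.span_of_finite F (Set.toFinite {a, b})
    have h1 := Submodule.finrank_mono h
    have h2 := finrank_range_le_card (R := F) ![a, b]
    rw [Matrix.range_cons_cons_empty, Set.finrank, Fintype.card_fin] at h2
    rw [hS.finrank_eq] at h1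
    omega
  obtain ⟨v, hv, hvn⟩ := Set.not_subset.1 this
  obtain ⟨hxS, hax, hbx⟩ := hproj v hv
  set x := v - (QuadraticMap.polar Q b v • a + QuadraticMap.polar Q a v • b)
  have hx0 : x ≠ 0 := by
    intro h
    apply hvn
    rw [SetLike.mem_coe, sub_eq_zero.1 h]
    exact Submodule.mem_span_pair.2 ⟨_, _, rfl⟩
  obtain ⟨z, hz, -, hxz⟩ := hS.exists_zero x hxS hx0
  obtain ⟨hyS, hay, hby⟩ := hproj z hz
  refine ⟨x, hxS, _, hyS, hax, hbx, hay, hby, ?_⟩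
  simp only [QuadraticMap.polar_sub_right, QuadraticMap.polar_add_right,
    QuadraticMap.polar_smul_right, hxz, QuadraticMap.polar_comm Q x a,
    QuadraticMap.polar_comm Q x b, hax, hbx, smul_zero, add_zero, sub_zero]

/-- At least a line of the singular plane `W` is orthogonal to `m`. Its vectors lie in `S` modulo
`m`, and as `S` contains no singular line, some combination of them is a nonzero multiple of `m`. -/
theorem mem_of_isotropic_plane {Q : QuadraticForm F V} {S W : Submodule F V}
    (hS : IsEllipticSection Q S) (hW : Module.finrank F W = 3) (hQW : ∀ w ∈ W, Q w = 0)
    {m : V} (hm : Q m = 0) (hdec : ∀ v, QuadraticMap.polar Q m v = 0 → ∃ t : F, v - t • m ∈ S) : m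
        ∈ W := by
  have hfin : FiniteDimensional F W := Module.finite_of_finrank_pos (by omega)
  set f : W →ₗ[F] F := (QuadraticMap.polarBilin Q m).comp W.subtype with hf
  have hker : 2 ≤ Module.finrank F (LinearMap.ker f) := by
    have h1 := LinearMap.finrank_range_add_finrank_ker f
    have h2 := Submodule.finrank_le (LinearMap.range f)
    rw [Module.finrank_self] at h2
    omega
  obtain ⟨w, hw⟩ := exists_linearIndependent_of_le_finrank hker
  have hw' : LinearIndependent F ![((w 0 : W) : V), ((w 1 : W) : V)] := by
    have h1 : w = ![w 0, w 1] := by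
      ext i
      fin_cases i <;> rfl
    rw [h1, LinearIndependent.pair_iff] at hw
    rw [LinearIndependent.pair_iff]
    intro s t hst
    exact hw s t (Subtype.ext (Subtype.ext hst))
  have hpol : ∀ i, QuadraticMap.polar Q m (w i : W) = 0 := fun i => (w i).2
  obtain ⟨t₀, h0⟩ := hdec _ (hpol 0)
  obtain ⟨t₁, h1⟩ := hdec _ (hpol 1)
  set u := ((w 0 : W) : V)
  set v := ((w 1 : W) : V)
  have huW : u ∈ W := (w 0 : W).2
  have hvW : v ∈ W := (w 1 : W).2
  have hum : QuadraticMap.polar Q u m = 0 := (QuadraticMap.polar_comm Q _ _).trans (hpol 0)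
  have hvm : QuadraticMap.polar Q v m = 0 := (QuadraticMap.polar_comm Q _ _).trans (hpol 1)
  have huv : QuadraticMap.polar Q u v = 0 := by
    rw [QuadraticMap.polar, hQW _ (W.add_mem huW hvW), hQW _ huW, hQW _ hvW]; ring
  have hsq : ∀ (z : V) (t : F), z ∈ W → QuadraticMap.polar Q z m = 0 → Q (z - t • m) = 0 := by
    intro z t hz hzm
    rw [sub_eq_add_neg, ← neg_smul, QuadraticMap.map_add Q, QuadraticMap.map_smul, hm, hQW z hz,
      QuadraticMap.polar_smul_right, hzm]
    simp
  have hdep := hS.noLine ⟨_, h0⟩ ⟨_, h1⟩ (hsq u t₀ huW hum) (hsq v t₁ hvW hvm) (by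
    change QuadraticMap.polar Q (u - t₀ • m) (v - t₁ • m) = 0
    simp only [QuadraticMap.polar_sub_left, QuadraticMap.polar_sub_right,
      QuadraticMap.polar_smul_left, QuadraticMap.polar_smul_right, polar_self_two, huv, hum,
      QuadraticMap.polar_comm Q m v, hvm]
    simp)
  rw [LinearIndependent.pair_iff] at hdep
  push Not at hdep
  obtain ⟨s, t, hst, hne⟩ := hdep
  have h2 : s • (u - t₀ • m) + t • (v - t₁ • m) = 0 := congrArg Subtype.val hst
  have h3 : s • u + t • v = (s * t₀ + t * t₁) • m := by
    rw [← sub_eq_zero, ← h2]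
    module
  by_cases h4 : s * t₀ + t * t₁ = 0
  · rw [h4, zero_smul] at h3
    obtain ⟨h5, h6⟩ := LinearIndependent.pair_iff.1 hw' s t h3
    exact absurd h6 (hne h5)
  · have h5 : m = (s * t₀ + t * t₁)⁻¹ • (s • u + t • v) := by
      rw [h3, inv_smul_smul₀ h4]
    rw [h5]
    exact W.smul_mem _ (W.add_mem (W.smul_mem _ huW) (W.smul_mem _ hvW))

/-- A nonzero singular m in the orthogonal complement of S would belong to a hyperbolic pair m, n
there. A totally singular plane would then contain both vectors, against B(m,n) = 1. Here
hyperbolicity of `Q` enters through its singular planes. -/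
theorem eq_zero_of_mem_polar {Q : QuadraticForm F V} (hQ : IsHyperbolicSpace Q)
    {S : Submodule F V} (hS : IsEllipticSection Q S) {m : V} (hm : m ∈ polar Q S)
    (hQm : Q m = 0) : m = 0 := by
  by_contra hm0
  obtain ⟨a, ha, ha0⟩ := hS.exists_ne_zero_mem
  obtain ⟨b, hb, -, hab⟩ := hS.exists_zero a ha ha0
  obtain ⟨x, hx, y, hy, hax, hbx, hay, hby, hxy⟩ := exists_pair_orthogonal hS ha hb hab
  obtain ⟨n', hn', hmn'⟩ := exists_polar_eq_one_of_orthogonal hQ hS hm hm0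
  obtain ⟨n, hn, hmn, hQn⟩ : ∃ n ∈ polar Q S, QuadraticMap.polar Q m n = 1 ∧ Q n = 0 := by
    refine ⟨n' + Q n' • m, Submodule.add_mem _ hn' (Submodule.smul_mem _ _ hm), ?_, ?_⟩
    · rw [QuadraticMap.polar_add_right, hmn', QuadraticMap.polar_smul_right, polar_self_two,
        smul_zero, add_zero]
    · rw [QuadraticMap.map_add Q, QuadraticMap.map_smul, hQm, QuadraticMap.polar_smul_right,
        QuadraticMap.polar_comm, hmn', smul_zero, add_zero, smul_eq_mul, mul_one,
        CharTwo.add_self_eq_zero]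
  have hfam := isSymplecticFamily_of_pairs ha hb hx hy hm hn hab hxy hmn hax hbx hay hby
  obtain ⟨e, he⟩ := hfam.exists_basis hQ.finrank_eq
  rw [← he] at hfam
  have e0 : e 0 = a := by rw [he]; rfl
  have e1 : e 1 = b := by rw [he]; rfl
  have e2 : e 2 = x := by rw [he]; rfl
  have e3 : e 3 = y := by rw [he]; rfl
  have e4 : e 4 = m := by rw [he]; rfl
  have e5 : e 5 = n := by rw [he]; rfl
  have hmem := hfam.mem_iff (S := S) (e0 ▸ ha) (e1 ▸ hb) (e2 ▸ hx) (e3 ▸ hy)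
    (e4 ▸ hm) (e5 ▸ hn)
  obtain ⟨W, hW, hQW⟩ := hQ.exists_plane
  have hmW : m ∈ W := by
    refine mem_of_isotropic_plane hS hW hQW hQm fun v hv => ⟨e.repr v 4, ?_⟩
    rw [QuadraticMap.polar_comm, ← e4, hfam.polar_four] at hv
    rw [hmem, ← e4]
    simp [hv]
  have hnW : n ∈ W := by
    refine mem_of_isotropic_plane hS hW hQW hQn fun v hv => ⟨e.repr v 5, ?_⟩
    rw [QuadraticMap.polar_comm, ← e5, hfam.polar_five] at hv
    rw [hmem, ← e5]
    simp [hv]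
  rw [QuadraticMap.polar, hQW _ (W.add_mem hmW hnW), hQW _ hmW, hQW _ hnW] at hmn
  simp at hmn

/-- The orthogonal complement of ⟨a, b⟩ in `S` and that of `S` in the whole space are both
anisotropic planes, so both can be normalised with the same `δ`. Hence Q(a) is the only other
parameter left in the equation. -/
theorem exists_isAdapted [Finite F] {Q : QuadraticForm F V} (hQ : IsHyperbolicSpace Q)
    {S : Submodule F V} (hS : IsEllipticSection Q S) {a : V} (ha : a ∈ S) (ha0 : a ≠ 0)
    {δ : F} (hδ : ¬ IsArtinSchreier δ) :
    ∃ e : Module.Basis (Fin 6) F V, IsAdapted Q S a δ e := by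
  obtain ⟨b, hb, hQb, hab⟩ := hS.exists_zero a ha ha0
  obtain ⟨x', hx', y', hy', hax', hbx', hay', hby', hxy'⟩ := exists_pair_orthogonal hS ha hb hab
  obtain ⟨x, ⟨⟨hx, hax⟩, hbx⟩, y, ⟨⟨hy, hay⟩, hby⟩, hQx, hxy, hQy⟩ := exists_normal_pair
    (T := S ⊓ LinearMap.ker (QuadraticMap.polarBilin Q a) ⊓
      LinearMap.ker (QuadraticMap.polarBilin Q b))
    (fun v ⟨⟨hv, hav⟩, hbv⟩ h0 => hS.eq_zero_of_orthogonal hb hab hQb hv hav hbv h0)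
    (x := x') (y := y') ⟨⟨hx', hax'⟩, hbx'⟩ ⟨⟨hy', hay'⟩, hby'⟩ hxy' hδ
  have hSV : ∃ v, v ∉ S := by
    by_contra! h
    have h1 : S = ⊤ := Submodule.eq_top_iff'.2 h
    have h2 := hS.finrank_eq
    rw [h1, finrank_top, hQ.finrank_eq] at h2
    omega
  obtain ⟨v, hv⟩ := hSV
  obtain ⟨s, hs, hm'⟩ := hS.exists_orthogonal_sub v
  have hm0 : v - s ≠ 0 := fun h => hv (sub_eq_zero.1 h ▸ hs)
  obtain ⟨n', hn', hmn'⟩ := exists_polar_eq_one_of_orthogonal hQ hS hm' hm0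
  obtain ⟨m, hm, n, hn, hQm, hmn, hQn⟩ := exists_normal_pair
    (fun w hw h0 => eq_zero_of_mem_polar hQ hS hw h0) hm' hn' hmn' hδ
  have hfam := isSymplecticFamily_of_pairs ha hb hx hy hm hn hab hxy hmn hax hbx hay hby
  obtain ⟨e, he⟩ := hfam.exists_basis hQ.finrank_eq
  rw [← he] at hfam
  have e0 : e 0 = a := by rw [he]; rfl
  have e1 : e 1 = b := by rw [he]; rfl
  have e2 : e 2 = x := by rw [he]; rfl
  have e3 : e 3 = y := by rw [he]; rfl
  have e4 : e 4 = m := by rw [he]; rfl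
  have e5 : e 5 = n := by rw [he]; rfl
  refine ⟨e, e0, fun v => ?_, hfam.mem_iff (S := S) (e0 ▸ ha) (e1 ▸ hb) (e2 ▸ hx) (e3 ▸ hy)
    (e4 ▸ hm) (e5 ▸ hn)⟩
  rw [hfam.apply_eq, e0, e1, e2, e3, e4, e5, hQb, hQx, hQy, hQm, hQn]
  unfold binForm
  ring

end Adapted

/-! ### Conics, hyperovals and classical ovoids in adapted coordinates. -/

section Coordinates

variable {F V : Type*} [Field F] [AddCommGroup V] [Module F V]

theorem repr_equivFun_symm {n : ℕ} (e : Module.Basis (Fin n) F V) (f : Fin n → F) (i : Fin n) :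
    e.repr (e.equivFun.symm f) i = f i := by
  rw [← Module.Basis.equivFun_apply, LinearEquiv.apply_symm_apply]

theorem exists_orthogonal_independent [CharP F 2] {Q : QuadraticForm F V} {S : Submodule F V}
    (hS : IsEllipticSection Q S) {s : V} (hs : s ∈ S) (hs0 : s ≠ 0) :
    ∃ x ∈ S, QuadraticMap.polar Q s x = 0 ∧ LinearIndependent F ![s, x] := by
  obtain ⟨b, hb, -, hab⟩ := hS.exists_zero s hs hs0
  obtain ⟨x, hx, y, hy, hax, -, hay, -, hxy⟩ := exists_pair_orthogonal hS hs hb hab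
  refine ⟨x, hx, hax, ?_⟩
  rw [LinearIndependent.pair_iff' hs0]
  rintro t rfl
  rw [QuadraticMap.polar_smul_left, hay, smul_zero] at hxy
  exact zero_ne_one hxy

namespace IsAdapted

variable {Q : QuadraticForm F V} {S : Submodule F V} {a : V} {δ : F}
  {e : Module.Basis (Fin 6) F V}

theorem basis_mem (h : IsAdapted Q S a δ e) {i : Fin 6} (hi : i < 4) : e i ∈ S := by
  rw [h.mem_iff]
  fin_cases i <;> simp_all

variable [CharP F 2]

theorem polar_eq (h : IsAdapted Q S a δ e) (v w : V) :
    QuadraticMap.polar Q v w = e.repr v 0 * e.repr w 1 + e.repr v 1 * e.repr w 0 +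
      (e.repr v 2 * e.repr w 3 + e.repr v 3 * e.repr w 2) +
      (e.repr v 4 * e.repr w 5 + e.repr v 5 * e.repr w 4) := by
  rw [QuadraticMap.polar, h.apply_eq, h.apply_eq v, h.apply_eq w]
  simp only [map_add, Finsupp.add_apply, binForm]
  linear_combination (Q a * e.repr v 0 * e.repr w 0 + e.repr v 2 * e.repr w 2 +
    e.repr v 4 * e.repr w 4 + δ * e.repr v 3 * e.repr w 3 + δ * e.repr v 5 * e.repr w 5) *
    CharTwo.two_eq_zero (R := F)

theorem polar_left (h : IsAdapted Q S a δ e) (v : V) : QuadraticMap.polar Q a v = e.repr v 1 := by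
  rw [h.polar_eq, ← h.zero_eq]
  simp

theorem mem_polar_iff (h : IsAdapted Q S a δ e) (v : V) :
    v ∈ polar Q S ↔
      e.repr v 0 = 0 ∧ e.repr v 1 = 0 ∧ e.repr v 2 = 0 ∧ e.repr v 3 = 0 := by
  rw [KleinHyperoval.mem_polar_iff]
  constructor
  · intro hv
    have h0 := hv _ (h.basis_mem (i := 0) (by decide))
    have h1 := hv _ (h.basis_mem (i := 1) (by decide))
    have h2 := hv _ (h.basis_mem (i := 2) (by decide))
    have h3 := hv _ (h.basis_mem (i := 3) (by decide))
    simp only [h.polar_eq] at h0 h1 h2 h3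
    simp at h0 h1 h2 h3
    exact ⟨h1, h0, h3, h2⟩
  · rintro ⟨h0, h1, h2, h3⟩ w hw
    obtain ⟨h4, h5⟩ := (h.mem_iff w).1 hw
    rw [h.polar_eq, h0, h1, h2, h3, h4, h5]
    ring

end IsAdapted

variable [CharP F 2]

theorem polar_shiftedForm (Q : QuadraticForm F V) (S : Submodule F V) (a : V) (x y : S) :
    QuadraticMap.polar (shiftedForm Q S a) x y = QuadraticMap.polar Q x y := by
  change _ = Q (x + y) - Q x - Q y
  rw [QuadraticMap.polar, shiftedForm_apply, shiftedForm_apply, shiftedForm_apply,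
    Submodule.coe_add, QuadraticMap.polar_add_right, CharTwo.add_sq]
  ring

variable [Finite F]

theorem span_pair_le_tangentSpan {Q : QuadraticForm F V} {S : Submodule F V}
    (hS : IsEllipticSection Q S) {s w : V} (hs : s ∈ S) (hs0 : s ≠ 0) (hw : w ∈ S)
    (hsw : QuadraticMap.polar Q s w = 0) (hli : LinearIndependent F ![s, w]) :
    Submodule.span F {s, w} ≤ tangentSpan Q S (Projectivization.mk F s hs0) := by
  refine le_sSup ⟨(isTangentLine_iff hS.noLine).2 ⟨?_, ?_, ?_⟩, ?_⟩
  · exact Submodule.span_le.2 (Set.insert_subset hs (Set.singleton_subset_iff.2 hw))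
  · have := finrank_span_eq_card hli
    rwa [Matrix.range_cons_cons_empty, Fintype.card_fin] at this
  · intro u hu v hv
    obtain ⟨α, β, rfl⟩ := Submodule.mem_span_pair.1 hu
    obtain ⟨α', β', rfl⟩ := Submodule.mem_span_pair.1 hv
    simp only [QuadraticMap.polar_add_left, QuadraticMap.polar_add_right,
      QuadraticMap.polar_smul_left, QuadraticMap.polar_smul_right, polar_self_two, hsw,
      QuadraticMap.polar_comm Q w s, smul_zero, add_zero]
  · exact (mk_mem_pointsOf hs0).2 (Submodule.subset_span (by simp))

theorem mem_tangentSpan_of_orthogonal {Q : QuadraticForm F V} {S : Submodule F V}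
    (hS : IsEllipticSection Q S) {s w : V} (hs : s ∈ S) (hs0 : s ≠ 0) (hw : w ∈ S)
    (hsw : QuadraticMap.polar Q s w = 0) : w ∈ tangentSpan Q S (Projectivization.mk F s hs0) := by
  by_cases hli : LinearIndependent F ![s, w]
  · exact span_pair_le_tangentSpan hS hs hs0 hw hsw hli (Submodule.subset_span (by simp))
  · rw [LinearIndependent.pair_iff' hs0] at hli
    push Not at hli
    obtain ⟨t, rfl⟩ := hli
    obtain ⟨x, hx, hsx, hli⟩ := exists_orthogonal_independent hS hs hs0
    exact Submodule.smul_mem _ _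
      (span_pair_le_tangentSpan hS hs hs0 hx hsx hli (Submodule.subset_span (by simp)))

/-- The plane π_s is the hyperplane of `S` orthogonal to s. A vector orthogonal to it has an
`S`-component orthogonal to this hyperplane, hence a multiple of s. -/
theorem mem_polar_tangentSpan_iff {Q : QuadraticForm F V} {S : Submodule F V}
    (hS : IsEllipticSection Q S) {s : V} (hs : s ∈ S) (hs0 : s ≠ 0) {v : V} :
    v ∈ polar Q (tangentSpan Q S (Projectivization.mk F s hs0)) ↔
      ∃ κ : F, v - κ • s ∈ polar Q S := by
  constructor
  · intro hv
    obtain ⟨u, hu, huv⟩ := hS.exists_orthogonal_sub v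
    obtain ⟨b, hb, -, hsb⟩ := hS.exists_zero s hs hs0
    have huw : ∀ w ∈ S, QuadraticMap.polar Q s w = 0 → QuadraticMap.polar Q u w = 0 := by
      intro w hw hsw
      have h1 := hv w (mem_tangentSpan_of_orthogonal hS hs hs0 hw hsw)
      have h2 := huv w hw
      change QuadraticMap.polar Q w v = 0 at h1
      change QuadraticMap.polar Q w (v - u) = 0 at h2
      rw [QuadraticMap.polar_sub_right, h1, zero_sub, neg_eq_zero] at h2
      rw [QuadraticMap.polar_comm, h2]
    have hus : u - QuadraticMap.polar Q u b • s = 0 := by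
      refine hS.nondegenerate _ (S.sub_mem hu (S.smul_mem _ hs)) fun w hw => ?_
      have h1 := huw (w - QuadraticMap.polar Q s w • b) (S.sub_mem hw (S.smul_mem _ hb)) (by
        rw [QuadraticMap.polar_sub_right, QuadraticMap.polar_smul_right, hsb, smul_eq_mul,
          mul_one, sub_self])
      rw [QuadraticMap.polar_sub_right, QuadraticMap.polar_smul_right, smul_eq_mul] at h1
      rw [QuadraticMap.polar_sub_left, QuadraticMap.polar_smul_left, smul_eq_mul]
      linear_combination h1
    exact ⟨QuadraticMap.polar Q u b, by rwa [← sub_eq_zero.1 hus]⟩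
  · rintro ⟨κ, hκ⟩
    have hle : tangentSpan Q S (Projectivization.mk F s hs0) ≤
        S ⊓ LinearMap.ker (QuadraticMap.polarBilin Q s) := by
      refine sSup_le fun L hL => ?_
      obtain ⟨hLS, -, hL0⟩ := (isTangentLine_iff hS.noLine).1 hL.1
      exact fun w hw => ⟨hLS hw, hL0 s ((mk_mem_pointsOf hs0).1 hL.2) w hw⟩
    intro w hw
    obtain ⟨hwS, hws⟩ := hle hw
    have h1 := hκ w hwS
    change QuadraticMap.polar Q w (v - κ • s) = 0 at h1
    change QuadraticMap.polar Q s w = 0 at hws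
    change QuadraticMap.polar Q w v = 0
    rw [QuadraticMap.polar_sub_right, QuadraticMap.polar_smul_right, QuadraticMap.polar_comm Q w s,
      hws, smul_zero, sub_zero] at h1
    exact h1

/-- Membership in the hyperoval, expressed by coordinates with respect to an adapted basis. -/
def InHyperoval (Q : QuadraticForm F V) (δ : F) (e : Module.Basis (Fin 6) F V) (v : V) : Prop :=
  Q v = 0 ∧ e.repr v 1 ≠ 0 ∧ (binForm δ (e.repr v 4) (e.repr v 5) = 0 ∨
    binForm δ (e.repr v 4) (e.repr v 5) = e.repr v 1 ^ 2)

namespace IsAdapted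

variable {Q : QuadraticForm F V} {S : Submodule F V} {a : V} {δ : F}
  {e : Module.Basis (Fin 6) F V}

/-- A point of a conic has the form v = κs + m with s on the ovoid and m orthogonal to `S`; since
Q(s) = B(a,s)², singularity of v means N(v₄,v₅) = κ²Q(s) = v₁². The points of Q⁻ off the ovoid are
those with v₄ = v₅ = 0 and v₁ ≠ 0. -/
theorem mk_mem_hyperovalOf (h : IsAdapted Q S a δ e) (hS : IsEllipticSection Q S)
    (hδ : ¬ IsArtinSchreier δ) {v : V} (hv : v ≠ 0) :
    Projectivization.mk F v hv ∈ hyperovalOf Q S (zeroSet S (shiftedForm Q S a)) ↔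
      InHyperoval Q δ e v := by
  rw [hyperovalOf, Set.mem_union, Set.mem_sdiff, sectionOf_eq_zeroSet, mk_mem_zeroSet,
    mk_mem_zeroSet]
  have hQ := h.apply_eq
  constructor
  · rintro (hx | ⟨⟨hvS, hQv⟩, hn⟩)
    · simp only [Set.mem_iUnion] at hx
      obtain ⟨p, ⟨hp1, hp2⟩, hpc⟩ := hx
      induction p using Projectivization.ind with
      | h s hs0 =>
      rw [mk_mem_zeroSet] at hp1 hp2
      obtain ⟨hs, hs1⟩ := hp1
      have hs2 : Q s ≠ 0 := fun h0 => hp2 ⟨hs, h0⟩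
      rw [shiftedForm_apply, h.polar_left, CharTwo.add_eq_zero] at hs1
      change Q s = _ at hs1
      rw [conic, Set.mem_inter_iff, mk_mem_pointsOf, mk_mem_quadric,
        mem_polar_tangentSpan_iff hS hs hs0] at hpc
      obtain ⟨⟨κ, hκ⟩, hQv⟩ := hpc
      obtain ⟨h0, h1, h2, h3⟩ := (h.mem_polar_iff _).1 hκ
      obtain ⟨h4, h5⟩ := (h.mem_iff s).1 hs
      simp only [map_sub, map_smul, Finsupp.sub_apply, Finsupp.smul_apply, smul_eq_mul,
        sub_eq_zero] at h0 h1 h2 h3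
      have hQs := hQ s
      have hQv' := hQ v
      rw [hQv, h0, h1, h2, h3] at hQv'
      rw [h4, h5] at hQs
      have hκs : binForm δ (e.repr v 4) (e.repr v 5) = κ ^ 2 * Q s := by
        rw [← CharTwo.add_eq_zero, hQs]
        unfold binForm at hQv' ⊢
        linear_combination -hQv'
      refine ⟨hQv, ?_, Or.inr ?_⟩
      · rw [h1]
        refine mul_ne_zero ?_ ?_
        · rintro rfl
          obtain ⟨h6, h7⟩ := binForm_eq_zero hδ (by rw [hκs]; ring)
          apply hv
          apply e.ext_elem
          intro i
          fin_cases i <;> simp [h0, h1, h2, h3, h6, h7]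
        · intro h6
          rw [h6] at hs1
          exact hs2 (by rw [hs1]; ring)
      · rw [hκs, hs1, h1]
        ring
    · change Q v = 0 at hQv
      obtain ⟨h4, h5⟩ := (h.mem_iff v).1 hvS
      refine ⟨hQv, fun h1 => hn ⟨hvS, ?_⟩, Or.inl ?_⟩
      · rw [shiftedForm_apply, h.polar_left]
        simp [hQv, h1]
      · rw [h4, h5]
        simp [binForm]
  · rintro ⟨hQv, h1, h0 | hb⟩
    · right
      have hvS : v ∈ S := (h.mem_iff v).2 (binForm_eq_zero hδ h0)
      refine ⟨⟨hvS, hQv⟩, ?_⟩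
      rintro ⟨_, h2⟩
      rw [shiftedForm_apply, h.polar_left] at h2
      simp [hQv, h1] at h2
    · left
      -- The point of the ovoid whose conic contains v is the projection of v to `S`.
      set s := e.equivFun.symm ![e.repr v 0, e.repr v 1, e.repr v 2, e.repr v 3, 0, 0] with hsdef
      have hr : ∀ i, e.repr s i = ![e.repr v 0, e.repr v 1, e.repr v 2, e.repr v 3, 0, 0] i :=
        repr_equivFun_symm e _
      have r0 : e.repr s 0 = e.repr v 0 := hr 0
      have r1 : e.repr s 1 = e.repr v 1 := hr 1
      have r2 : e.repr s 2 = e.repr v 2 := hr 2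
      have r3 : e.repr s 3 = e.repr v 3 := hr 3
      have r4 : e.repr s 4 = 0 := hr 4
      have r5 : e.repr s 5 = 0 := hr 5
      have hs : s ∈ S := (h.mem_iff s).2 ⟨r4, r5⟩
      have hQs : Q s = e.repr v 1 ^ 2 := by
        have h3 := hQ v
        rw [hQv, hb] at h3
        rw [← CharTwo.add_eq_zero, hQ, r0, r1, r2, r3, r4, r5]
        unfold binForm at h3 ⊢
        linear_combination -h3
      have hs0 : s ≠ 0 := by
        intro h3
        rw [h3, map_zero] at r1
        exact h1 r1.symm
      simp only [Set.mem_iUnion]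
      refine ⟨Projectivization.mk F s hs0, ⟨?_, ?_⟩, ?_⟩
      · rw [mk_mem_zeroSet]
        refine ⟨hs, ?_⟩
        rw [shiftedForm_apply, h.polar_left]
        change Q s + e.repr s 1 ^ 2 = 0
        rw [hQs, r1, CharTwo.add_self_eq_zero]
      · rw [mk_mem_zeroSet]
        rintro ⟨_, h3⟩
        change Q s = 0 at h3
        rw [hQs] at h3
        exact h1 (pow_eq_zero_iff two_ne_zero |>.1 h3)
      · rw [conic, Set.mem_inter_iff, mk_mem_pointsOf, mk_mem_quadric,
          mem_polar_tangentSpan_iff hS hs hs0]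
        refine ⟨⟨1, ?_⟩, hQv⟩
        rw [h.mem_polar_iff]
        simp [r0, r1, r2, r3]

end IsAdapted

/-- If Q(a) were not an Artin–Schreier value, it could serve as δ. The shifted form would then be a
sum of two isometric anisotropic planes, and matching their bases produces a line of zeros. -/
theorem isArtinSchreier_of_noLine {Q : QuadraticForm F V} (hQ : IsHyperbolicSpace Q)
    {S : Submodule F V} (hS : IsEllipticSection Q S) {a : V} (ha : a ∈ S) (ha0 : a ≠ 0)
    (hn : NoLine (shiftedForm Q S a)) : IsArtinSchreier (Q a) := by
  by_contra hδ
  obtain ⟨e, he⟩ := exists_isAdapted hQ hS ha ha0 hδ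
  have hu : e 1 + e 2 ∈ S := S.add_mem (he.basis_mem (by decide)) (he.basis_mem (by decide))
  have hw : e 0 + e 3 ∈ S := S.add_mem (he.basis_mem (by decide)) (he.basis_mem (by decide))
  refine hn ⟨_, hu⟩ ⟨_, hw⟩ ?_ ?_ ?_ ?_
  · rw [shiftedForm_apply, he.polar_left, he.apply_eq]
    simp [binForm, CharTwo.add_self_eq_zero]
  · rw [shiftedForm_apply, he.polar_left, he.apply_eq]
    simp [binForm, CharTwo.add_self_eq_zero]
  · rw [polar_shiftedForm, he.polar_eq]
    simp [CharTwo.add_self_eq_zero]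
  · rw [LinearIndependent.pair_iff]
    intro s t hst
    have h1 : s • (e 1 + e 2) + t • (e 0 + e 3) = 0 := congrArg Subtype.val hst
    have h2 := congrArg (fun v => e.repr v 1) h1
    have h3 := congrArg (fun v => e.repr v 0) h1
    simp at h2 h3
    exact ⟨h2, h3⟩

/-- With Q(a) = t² + t, the part x₁² + x₀x₁ + Q(a)x₀² splits as (x₁ + tx₀)(x₁ + (t+1)x₀), a
hyperbolic plane. -/
theorem exists_basis_shiftedForm {Q : QuadraticForm F V} (hQ : IsHyperbolicSpace Q)
    {S : Submodule F V} (hS : IsEllipticSection Q S) {a : V} (ha : a ∈ S) (ha0 : a ≠ 0)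
    (hc : IsArtinSchreier (Q a)) {δ : F} (hδ : ¬ IsArtinSchreier δ) :
    ∃ b : Module.Basis (Fin 4) F S, ∀ w, shiftedForm Q S a w = ellipticForm b 1 1 δ w := by
  obtain ⟨t, ht⟩ := hc
  obtain ⟨e, he⟩ := exists_isAdapted hQ hS ha ha0 hδ
  set f : S →ₗ[F] (Fin 4 → F) := LinearMap.pi ![(e.coord 1 + t • e.coord 0).comp S.subtype,
    (e.coord 1 + (t + 1) • e.coord 0).comp S.subtype, (e.coord 2).comp S.subtype,
    (e.coord 3).comp S.subtype] with hf
  have f0 : ∀ w, f w 0 = e.repr w 1 + t * e.repr w 0 := fun w => rfl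
  have f1 : ∀ w, f w 1 = e.repr w 1 + (t + 1) * e.repr w 0 := fun w => rfl
  have f2 : ∀ w, f w 2 = e.repr w 2 := fun w => rfl
  have f3 : ∀ w, f w 3 = e.repr w 3 := fun w => rfl
  have hinj : Function.Injective f := by
    rw [injective_iff_map_eq_zero]
    intro w hw
    have g0 := f0 w
    have g1 := f1 w
    have g2 := f2 w
    have g3 := f3 w
    rw [hw, Pi.zero_apply] at g0 g1 g2 g3
    have k0 : e.repr w 0 = 0 := by linear_combination g0 - g1
    have k1 : e.repr w 1 = 0 := by linear_combination -g0 - t * k0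
    obtain ⟨k4, k5⟩ := (he.mem_iff w).1 w.2
    apply Subtype.ext
    apply e.ext_elem
    intro i
    fin_cases i <;> simp [k0, k1, k4, k5, g2.symm, g3.symm]
  have hfin : FiniteDimensional F S :=
    Module.finite_of_finrank_pos (by rw [hS.finrank_eq]; norm_num)
  set E := f.linearEquivOfInjective hinj (by rw [hS.finrank_eq, Module.finrank_fin_fun]) with hE
  refine ⟨Module.Basis.ofEquivFun E, fun w => ?_⟩
  have hEf : ∀ i, E w i = f w i := fun i => rfl
  obtain ⟨k4, k5⟩ := (he.mem_iff w).1 w.2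
  rw [ellipticForm_apply, shiftedForm_apply, he.polar_left]
  simp only [Module.Basis.ofEquivFun_repr_apply, hEf, f0, f1, f2, f3]
  rw [he.apply_eq, k4, k5, ← ht]
  unfold binForm
  linear_combination (-t * e.repr w 0 * e.repr w 1) * CharTwo.two_eq_zero (R := F)

theorem classicalHyperovals_eq {Q : QuadraticForm F V} (hQ : IsHyperbolicSpace Q)
    {S : Submodule F V} (hS : IsEllipticSection Q S) :
    classicalHyperovals Q S = (fun a => hyperovalOf Q S (zeroSet S (shiftedForm Q S a))) ''
      {a | a ∈ S ∧ a ≠ 0 ∧ IsArtinSchreier (Q a)} := by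
  ext H
  constructor
  · rintro ⟨O, hO, hE, hne, rfl⟩
    obtain ⟨a, ha, rfl, hn⟩ := exists_zeroSet_shiftedForm hS hO hE
    have ha0 : a ≠ 0 := by
      rintro rfl
      apply hne
      rw [sectionOf_eq_zeroSet]
      apply zeroSet_congr
      intro w
      rw [shiftedForm_apply, restrictTo_apply]
      simp
    exact ⟨a, ⟨ha, ha0, isArtinSchreier_of_noLine hQ hS ha ha0 hn⟩, rfl⟩
  · rintro ⟨a, ⟨ha, ha0, hc⟩, rfl⟩
    obtain ⟨δ, hδ⟩ := exists_not_isArtinSchreier F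
    obtain ⟨b, hb⟩ := exists_basis_shiftedForm hQ hS ha ha0 hc hδ
    have hg : ∀ s t : F, 1 * s ^ 2 + 1 * (s * t) + δ * t ^ 2 = 0 → s = 0 ∧ t = 0 := by
      intro s t h
      exact binForm_eq_zero hδ (by unfold binForm; linear_combination h)
    refine ⟨_, ⟨fun p hp => hp.1, fun L hL => ?_⟩, ?_, ?_, rfl⟩
    · obtain ⟨hLS, hL2, hL0⟩ := (isTangentLine_iff hS.noLine).1 hL
      refine existsUnique_of_polar_eq_zero ((noLine_ellipticForm b hg).congr fun w => by rw [hb])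
        hLS hL2 fun x y hx hy => ?_
      rw [polar_shiftedForm]
      exact hL0 x hx y hy
    · exact isEllipticQuadric_iff.2 ⟨b, 1, 1, δ, hg, zeroSet_congr fun w => by rw [hb]⟩
    · intro h
      rw [sectionOf_eq_zeroSet] at h
      obtain ⟨z, hz, hQz, haz⟩ := hS.exists_zero a ha ha0
      have h1 := (apply_eq_zero_iff_of_zeroSet_eq h ⟨z, hz⟩).2 hQz
      rw [shiftedForm_apply] at h1
      simp [hQz, haz] at h1

end Coordinates

/-! ### The anisotropic plane and its conic with nucleus. -/

section BinaryForms

variable {F : Type*} [Field F] [CharP F 2]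

theorem binForm_add_mul (δ r s p q τ : F) : binForm δ (r + τ * p) (s + τ * q) =
    binForm δ r s + τ * (r * q + s * p) + τ ^ 2 * binForm δ p q := by
  unfold binForm
  linear_combination (r * τ * p + δ * s * τ * q) * CharTwo.two_eq_zero (R := F)

/-- For a pair with polar value 1 the product is the Arf invariant of an anisotropic plane.
Explicitly, c N(r,s) = t² + t with c = N(p,q) makes c(r,s) + t(p,q) a zero of N, which forces c = 0.
-/
theorem not_isArtinSchreier_mul_binForm {δ : F} (hδ : ¬ IsArtinSchreier δ) {p q r s : F}
    (h : p * s + q * r = 1) : ¬ IsArtinSchreier (binForm δ p q * binForm δ r s) := by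
  rintro ⟨t, ht⟩
  set c := binForm δ p q with hc
  have hz : binForm δ (c * r + t * p) (c * s + t * q) = 0 := by
    rw [binForm_add_mul, binForm_smul, ← hc]
    linear_combination c * (c * binForm δ r s) * CharTwo.two_eq_zero (R := F) + c * ht +
      t * c * h
  obtain ⟨h1, h2⟩ := binForm_eq_zero hδ hz
  have hc0 : c = 0 := by
    linear_combination p * h2 + q * h1 - c * h - t * p * q * CharTwo.two_eq_zero (R := F)
  obtain ⟨h3, h4⟩ := binForm_eq_zero hδ hc0
  rw [h3, h4] at h
  simp at h

/-- A line `r + τp` through a point of the hyperoval `N = 0` or `N = z²` of the affine plane meets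
it in a second point. -/
theorem exists_second_point [Finite F] {δ : F} (hδ : ¬ IsArtinSchreier δ) {r s p q z : F}
    (hz : z ≠ 0) (hpq : ¬ (p = 0 ∧ q = 0)) (hrs : binForm δ r s = 0 ∨ binForm δ r s = z ^ 2) :
    ∃ τ₀ : F, τ₀ ≠ 0 ∧ ∀ τ, (binForm δ (r + τ * p) (s + τ * q) = 0 ∨
      binForm δ (r + τ * p) (s + τ * q) = z ^ 2) ↔ τ = 0 ∨ τ = τ₀ := by
  have hP : binForm δ p q ≠ 0 := fun h => hpq (binForm_eq_zero hδ h)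
  obtain ⟨ρ, hρ⟩ := exists_sq_eq (z ^ 2 / binForm δ p q)
  have hρ' : ρ ^ 2 * binForm δ p q = z ^ 2 := by rw [hρ, div_mul_cancel₀ _ hP]
  have hρ0 : ρ ≠ 0 := by
    rintro rfl
    apply hz
    apply pow_eq_zero_iff two_ne_zero |>.1
    rw [← hρ']
    ring
  have hsq : ∀ τ, τ ^ 2 * binForm δ p q = z ^ 2 ↔ τ = ρ := by
    intro τ
    rw [← hρ']
    exact ⟨fun h => sq_inj_two (mul_right_cancel₀ hP h), fun h => by rw [h]⟩
  have hsq0 : ∀ τ, τ ^ 2 * binForm δ p q = 0 ↔ τ = 0 := by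
    intro τ
    rw [mul_eq_zero, or_iff_left hP, pow_eq_zero_iff two_ne_zero]
  -- Three cases: through the nucleus the second point is on the conic; along a tangent (vanishing
  -- polar value) it is the nucleus; along a secant it is the other conic point.
  rcases hrs with h | h
  · obtain ⟨rfl, rfl⟩ := binForm_eq_zero hδ h
    refine ⟨ρ, hρ0, fun τ => ?_⟩
    rw [binForm_add_mul, h, zero_mul, zero_mul, add_zero, mul_zero, add_zero, zero_add, hsq0, hsq]
  · by_cases hβ : r * q + s * p = 0
    · refine ⟨ρ, hρ0, fun τ => ?_⟩
      rw [binForm_add_mul, h, hβ, mul_zero, add_zero, CharTwo.add_eq_zero, eq_comm, hsq,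
        add_eq_left, hsq0]
      exact or_comm
    · refine ⟨(r * q + s * p) / binForm δ p q, div_ne_zero hβ hP, fun τ => ?_⟩
      rw [or_iff_right, binForm_add_mul, h, add_assoc, add_eq_left, eq_div_iff hP]
      · rw [show τ * (r * q + s * p) + τ ^ 2 * binForm δ p q =
          τ * (r * q + s * p + τ * binForm δ p q) by ring, mul_eq_zero, CharTwo.add_eq_zero]
        exact or_congr_right eq_comm
      · intro h0
        obtain ⟨h1, h2⟩ := binForm_eq_zero hδ h0
        exact hβ (by linear_combination q * h1 + p * h2 - τ * p * q * CharTwo.two_eq_zero (R := F))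

end BinaryForms

/-! ### Points whose perp misses the hyperoval, and the hyperoval property. -/

section Avoiding

variable {F V : Type*} [Field F] [AddCommGroup V] [Module F V]

/-- The singular vectors that are orthogonal to no vector satisfying `H`. -/
def Avoids (Q : QuadraticForm F V) (H : V → Prop) (k : V) : Prop :=
  k ≠ 0 ∧ Q k = 0 ∧ ∀ v, H v → QuadraticMap.polar Q k v ≠ 0

theorem inHyperoval_smul_iff {Q : QuadraticForm F V} {δ : F} {e : Module.Basis (Fin 6) F V}
    {t : F} (ht : t ≠ 0) (v : V) : InHyperoval Q δ e (t • v) ↔ InHyperoval Q δ e v := by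
  rw [InHyperoval, InHyperoval, QuadraticMap.map_smul]
  simp only [map_smul, Finsupp.smul_apply, smul_eq_mul, binForm_smul, mul_pow, mul_eq_zero, ne_eq,
    or_self, ht, pow_eq_zero_iff two_ne_zero, false_or, mul_right_inj' (pow_ne_zero 2 ht)]

namespace IsAdapted

variable {Q : QuadraticForm F V} {S : Submodule F V} {a : V} {δ : F}
  {e : Module.Basis (Fin 6) F V}

theorem apply_symm (h : IsAdapted Q S a δ e) (x₀ x₁ x₂ x₃ x₄ x₅ : F) :
    Q (e.equivFun.symm ![x₀, x₁, x₂, x₃, x₄, x₅]) =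
      Q a * x₀ ^ 2 + x₀ * x₁ + binForm δ x₂ x₃ + binForm δ x₄ x₅ := by
  rw [h.apply_eq]
  simp only [repr_equivFun_symm]
  rfl

theorem inHyperoval_symm (h : IsAdapted Q S a δ e) (x₀ x₁ x₂ x₃ x₄ x₅ : F) :
    InHyperoval Q δ e (e.equivFun.symm ![x₀, x₁, x₂, x₃, x₄, x₅]) ↔
      Q a * x₀ ^ 2 + x₀ * x₁ + binForm δ x₂ x₃ + binForm δ x₄ x₅ = 0 ∧ x₁ ≠ 0 ∧
        (binForm δ x₄ x₅ = 0 ∨ binForm δ x₄ x₅ = x₁ ^ 2) := by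
  rw [InHyperoval, h.apply_symm]
  simp only [repr_equivFun_symm]
  rfl

theorem inHyperoval_basis_one (h : IsAdapted Q S a δ e) : InHyperoval Q δ e (e 1) := by
  rw [InHyperoval, h.apply_eq]
  simp [binForm]

variable [CharP F 2]

theorem polar_symm (h : IsAdapted Q S a δ e) (v : V) (x₀ x₁ x₂ x₃ x₄ x₅ : F) :
    QuadraticMap.polar Q v (e.equivFun.symm ![x₀, x₁, x₂, x₃, x₄, x₅]) =
      e.repr v 0 * x₁ + e.repr v 1 * x₀ + (e.repr v 2 * x₃ + e.repr v 3 * x₂) +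
      (e.repr v 4 * x₅ + e.repr v 5 * x₄) := by
  rw [h.polar_eq]
  simp only [repr_equivFun_symm]
  rfl

/-- If k were orthogonal to v, the scaled pairs (k₂,k₃)/k₀ and (v₂,v₃)/v₁ would have polar value 1.
The product of their N-values is (Q(a)v₀/v₁)² + Q(a)v₀/v₁ plus 0 or Q(a), an Artin–Schreier value,
against `not_isArtinSchreier_mul_binForm`. -/
theorem polar_ne_zero_of_mem (h : IsAdapted Q S a δ e) (hδ : ¬ IsArtinSchreier δ)
    (hc : IsArtinSchreier (Q a)) {k v : V} (hk0 : k ≠ 0) (hQk : Q k = 0) (h1 : e.repr k 1 = 0)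
    (h4 : e.repr k 4 = 0) (h5 : e.repr k 5 = 0) (hv : InHyperoval Q δ e v) :
    QuadraticMap.polar Q k v ≠ 0 := by
  intro hkv
  obtain ⟨hQv, hv1, hv2⟩ := hv
  rw [h.polar_eq, h1, h4, h5] at hkv
  rw [h.apply_eq, h1, h4, h5] at hQk
  rw [h.apply_eq] at hQv
  have hN0 : binForm δ (0 : F) 0 = 0 := by simp [binForm]
  have hN : binForm δ (e.repr k 2) (e.repr k 3) = Q a * e.repr k 0 ^ 2 := by
    rw [← CharTwo.add_eq_zero]
    linear_combination hQk - hN0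
  have hk : e.repr k 0 ≠ 0 := by
    intro h0
    rw [h0] at hN
    obtain ⟨h2, h3⟩ := binForm_eq_zero hδ (by rw [hN]; ring)
    apply hk0
    apply e.ext_elem
    intro i
    fin_cases i <;> simp [h0, h1, h2, h3, h4, h5]
  set x := e.repr k
  set y := e.repr v
  have hB : (x 0)⁻¹ * x 2 * ((y 1)⁻¹ * y 3) + (x 0)⁻¹ * x 3 * ((y 1)⁻¹ * y 2) = 1 := by
    field_simp
    linear_combination hkv - x 0 * y 1 * CharTwo.two_eq_zero (R := F)
  apply not_isArtinSchreier_mul_binForm hδ hB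
  rw [binForm_smul, binForm_smul, hN]
  have hε : IsArtinSchreier (Q a * ((y 1)⁻¹ ^ 2 * binForm δ (y 4) (y 5))) := by
    rcases hv2 with h0 | h0
    · rw [h0, mul_zero, mul_zero]
      exact isArtinSchreier_zero
    · rw [h0, ← mul_pow, inv_mul_cancel₀ hv1, one_pow, mul_one]
      exact hc
  have h6 : (x 0)⁻¹ ^ 2 * (Q a * x 0 ^ 2) * ((y 1)⁻¹ ^ 2 * binForm δ (y 2) (y 3)) =
      ((Q a * (y 0 / y 1)) ^ 2 + Q a * (y 0 / y 1)) +
        Q a * ((y 1)⁻¹ ^ 2 * binForm δ (y 4) (y 5)) := by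
    rw [← CharTwo.add_eq_zero]
    field_simp
    linear_combination Q a * hQv
  rw [h6]
  exact IsArtinSchreier.add ⟨_, rfl⟩ hε

/-- The same argument in the last two coordinates, where the product of the N-values is simply 0 or
Q(a). -/
theorem polar_ne_zero_of_mem_polar (h : IsAdapted Q S a δ e) (hδ : ¬ IsArtinSchreier δ)
    (hc : IsArtinSchreier (Q a)) {k v : V} (hk0 : k ≠ 0) (hQk : Q k = 0) (h1 : e.repr k 1 = 0)
    (h2 : e.repr k 2 = 0) (h3 : e.repr k 3 = 0) (hv : InHyperoval Q δ e v) :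
    QuadraticMap.polar Q k v ≠ 0 := by
  intro hkv
  obtain ⟨hQv, hv1, hv2⟩ := hv
  rw [h.polar_eq, h1, h2, h3] at hkv
  rw [h.apply_eq, h1, h2, h3] at hQk
  have hN0 : binForm δ (0 : F) 0 = 0 := by simp [binForm]
  have hN : binForm δ (e.repr k 4) (e.repr k 5) = Q a * e.repr k 0 ^ 2 := by
    rw [← CharTwo.add_eq_zero]
    linear_combination hQk - hN0
  have hk : e.repr k 0 ≠ 0 := by
    intro h0
    rw [h0] at hN
    obtain ⟨h4, h5⟩ := binForm_eq_zero hδ (by rw [hN]; ring)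
    apply hk0
    apply e.ext_elem
    intro i
    fin_cases i <;> simp [h0, h1, h2, h3, h4, h5]
  set x := e.repr k
  set y := e.repr v
  have hB : (x 0)⁻¹ * x 4 * ((y 1)⁻¹ * y 5) + (x 0)⁻¹ * x 5 * ((y 1)⁻¹ * y 4) = 1 := by
    field_simp
    linear_combination hkv - x 0 * y 1 * CharTwo.two_eq_zero (R := F)
  apply not_isArtinSchreier_mul_binForm hδ hB
  rw [binForm_smul, binForm_smul, hN,
    show (x 0)⁻¹ ^ 2 * (Q a * x 0 ^ 2) = Q a by field_simp]
  rcases hv2 with h0 | h0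
  · rw [h0, mul_zero, mul_zero]
    exact isArtinSchreier_zero
  · rw [h0, ← mul_pow, inv_mul_cancel₀ hv1, one_pow, mul_one]
    exact hc

theorem exists_avoids (h : IsAdapted Q S a δ e) (hδ : ¬ IsArtinSchreier δ)
    (hc : IsArtinSchreier (Q a)) {p q : F} (hpq : ¬ (p = 0 ∧ q = 0)) {ρ : F}
    (hρ : Q a * ρ ^ 2 = binForm δ p q) :
    Avoids Q (InHyperoval Q δ e) (e.equivFun.symm ![ρ, 0, p, q, 0, 0]) ∧
      Avoids Q (InHyperoval Q δ e) (e.equivFun.symm ![ρ, 0, 0, 0, p, q]) := by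
  have hN0 : binForm δ (0 : F) 0 = 0 := by simp [binForm]
  have hQ1 : Q (e.equivFun.symm ![ρ, 0, p, q, 0, 0]) = 0 := by
    rw [h.apply_symm, hρ, hN0]
    linear_combination binForm δ p q * CharTwo.two_eq_zero (R := F)
  have hQ2 : Q (e.equivFun.symm ![ρ, 0, 0, 0, p, q]) = 0 := by
    rw [h.apply_symm, hρ, hN0]
    linear_combination binForm δ p q * CharTwo.two_eq_zero (R := F)
  have hρ0 : ρ ≠ 0 := by
    rintro rfl
    exact hpq (binForm_eq_zero hδ (by rw [← hρ]; ring))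
  have hne : ∀ f : Fin 6 → F, f 0 = ρ → e.equivFun.symm f ≠ 0 := by
    intro f hf h0
    have h1 := repr_equivFun_symm e f 0
    rw [h0, hf, LinearEquiv.map_zero] at h1
    exact hρ0 h1.symm
  refine ⟨⟨hne _ rfl, hQ1, fun v hv => ?_⟩, ⟨hne _ rfl, hQ2, fun v hv => ?_⟩⟩
  · exact h.polar_ne_zero_of_mem hδ hc (hne _ rfl) hQ1 (repr_equivFun_symm _ _ _)
      (repr_equivFun_symm _ _ _) (repr_equivFun_symm _ _ _) hv
  · exact h.polar_ne_zero_of_mem_polar hδ hc (hne _ rfl) hQ2 (repr_equivFun_symm _ _ _)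
      (repr_equivFun_symm _ _ _) (repr_equivFun_symm _ _ _) hv

variable [Finite F]

theorem repr_one_eq_zero_of_avoids (h : IsAdapted Q S a δ e) (hδ : ¬ IsArtinSchreier δ) {k : V}
    (hk : Avoids Q (InHyperoval Q δ e) k) : e.repr k 1 = 0 := by
  by_contra h1
  obtain ⟨hk0, hQk, hav⟩ := hk
  set x := e.repr k with hx
  have hQ := h.apply_eq k
  rw [hQk, ← hx] at hQ
  have hN0 : binForm δ (0 : F) 0 = 0 := by simp [binForm]
  -- If `x 1 ≠ 0`, a solution of this equation gives a point of the hyperoval inside `S` orthogonal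
  -- to `k`. Taking (u,v) proportional to (x₂,x₃) kills the first square; if x₂ = x₃ = 0 it vanishes
  -- anyway.
  have key : ∀ u v : F, Q a * (x 2 * v + x 3 * u) ^ 2 + x 1 ^ 2 * binForm δ u v =
      binForm δ (x 4) (x 5) → False := by
    intro u v huv
    refine hav (e.equivFun.symm ![x 0 + (x 2 * v + x 3 * u), x 1, x 2 + x 1 * u, x 3 + x 1 * v,
      0, 0]) ?_ ?_
    · rw [h.inHyperoval_symm]
      refine ⟨?_, h1, Or.inl hN0⟩
      rw [binForm_add_mul, hN0]
      linear_combination -hQ + huv + (Q a * x 0 * (x 2 * v + x 3 * u) +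
        x 1 * (x 2 * v + x 3 * u)) * CharTwo.two_eq_zero (R := F)
    · rw [h.polar_symm]
      linear_combination (x 0 * x 1 + x 2 * x 3 + x 1 * (x 2 * v + x 3 * u)) *
        CharTwo.two_eq_zero (R := F)
  obtain ⟨r, hr⟩ := exists_sq_eq (binForm δ (x 4) (x 5))
  by_cases hn : binForm δ (x 2) (x 3) = 0
  · obtain ⟨h2, h3⟩ := binForm_eq_zero hδ hn
    refine key (r / x 1) 0 ?_
    rw [h2, h3, ← hr]
    unfold binForm
    field_simp
    ring
  · obtain ⟨τ, hτ⟩ := exists_sq_eq (binForm δ (x 4) (x 5) / binForm δ (x 2) (x 3))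
    refine key (τ / x 1 * x 2) (τ / x 1 * x 3) ?_
    rw [binForm_smul]
    have : τ ^ 2 * binForm δ (x 2) (x 3) = binForm δ (x 4) (x 5) := by
      rw [hτ, div_mul_cancel₀ _ hn]
    field_simp
    linear_combination x 1 ^ 2 * this + (Q a * x 2 ^ 2 * x 3 ^ 2 * τ ^ 2) * 2 *
      CharTwo.two_eq_zero (R := F)

/-- When Q(a) = 0, testing k against the points (N(u,v), 1, u, v, 0, 0) leaves an affine function of
(u,v) without zeros. So k₂ = k₃ = 0, and singularity then makes k a multiple of a. -/
theorem polar_eq_zero_of_avoids (h : IsAdapted Q S a δ e) (hδ : ¬ IsArtinSchreier δ)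
    (ha : Q a = 0) {k l : V} (hk : Avoids Q (InHyperoval Q δ e) k)
    (hl : Avoids Q (InHyperoval Q δ e) l) : QuadraticMap.polar Q k l = 0 := by
  have key : ∀ k, Avoids Q (InHyperoval Q δ e) k →
      e.repr k 2 = 0 ∧ e.repr k 3 = 0 ∧ e.repr k 4 = 0 ∧ e.repr k 5 = 0 := by
    intro k hk
    have h1 := h.repr_one_eq_zero_of_avoids hδ hk
    obtain ⟨-, hQk, hav⟩ := hk
    have hN0 : binForm δ (0 : F) 0 = 0 := by simp [binForm]
    have hv : ∀ u v : F, e.repr k 0 + (e.repr k 2 * v + e.repr k 3 * u) ≠ 0 := by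
      intro u v h0
      refine hav (e.equivFun.symm ![binForm δ u v, 1, u, v, 0, 0]) ?_ ?_
      · rw [h.inHyperoval_symm]
        refine ⟨?_, one_ne_zero, Or.inl hN0⟩
        rw [ha, hN0]
        linear_combination binForm δ u v * CharTwo.two_eq_zero (R := F)
      · rw [h.polar_symm, h1]
        linear_combination h0
    have h2 : e.repr k 2 = 0 := by
      by_contra h2
      exact hv 0 (-e.repr k 0 / e.repr k 2) (by field_simp; ring)
    have h3 : e.repr k 3 = 0 := by
      by_contra h3
      exact hv (-e.repr k 0 / e.repr k 3) 0 (by field_simp; ring)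
    rw [h.apply_eq, h1, h2, h3, ha, hN0] at hQk
    exact ⟨h2, h3, binForm_eq_zero hδ (by linear_combination hQk)⟩
  obtain ⟨h2, h3, h4, h5⟩ := key k hk
  rw [h.polar_eq, h2, h3, h4, h5, h.repr_one_eq_zero_of_avoids hδ hk,
    h.repr_one_eq_zero_of_avoids hδ hl]
  ring

theorem exists_avoids_pair (h : IsAdapted Q S a δ e) (hδ : ¬ IsArtinSchreier δ)
    (hc : IsArtinSchreier (Q a)) (ha : Q a ≠ 0) : ∃ k l, Avoids Q (InHyperoval Q δ e) k ∧
      Avoids Q (InHyperoval Q δ e) l ∧ QuadraticMap.polar Q k l ≠ 0 := by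
  obtain ⟨ρ, hρ⟩ := exists_sq_eq (binForm δ 1 0 / Q a)
  obtain ⟨ρ', hρ'⟩ := exists_sq_eq (binForm δ 0 1 / Q a)
  refine ⟨_, _, (h.exists_avoids hδ hc (p := 1) (q := 0) (by simp)
    (ρ := ρ) (by rw [hρ]; field_simp)).1, (h.exists_avoids hδ hc (p := 0) (q := 1) (by simp)
    (ρ := ρ') (by rw [hρ']; field_simp)).1, ?_⟩
  rw [h.polar_symm]
  simp only [repr_equivFun_symm]
  simp

theorem eq_smul_of_orthogonal_avoids (h : IsAdapted Q S a δ e) (hδ : ¬ IsArtinSchreier δ)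
    (hc : IsArtinSchreier (Q a)) (ha : Q a ≠ 0) {w : V}
    (hw : ∀ k, Avoids Q (InHyperoval Q δ e) k → QuadraticMap.polar Q w k = 0) : w = e.repr w 0 • a
        := by
  obtain ⟨ρ, hρ⟩ := exists_sq_eq (binForm δ 1 0 / Q a)
  -- N(0,1) = N(1,1) = δ, so two avoiding vectors share ρ'; comparing their equations isolates one
  -- coordinate.
  obtain ⟨ρ', hρ'⟩ := exists_sq_eq (δ / Q a)
  have hρ0 : ρ ≠ 0 := by
    rintro rfl
    have : binForm δ (1 : F) 0 / Q a ≠ 0 := by simp [binForm, ha]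
    exact this (by rw [← hρ]; ring)
  have e10 := h.exists_avoids hδ hc (p := 1) (q := 0) (by simp) (ρ := ρ)
    (by rw [hρ]; field_simp)
  have e01 := h.exists_avoids hδ hc (p := 0) (q := 1) (by simp) (ρ := ρ')
    (by rw [hρ']; unfold binForm; field_simp; ring)
  have e11 := h.exists_avoids hδ hc (p := 1) (q := 1) (by simp) (ρ := ρ')
    (by
      rw [hρ']
      unfold binForm
      field_simp
      linear_combination -CharTwo.two_eq_zero (R := F))
  have w1 := hw _ e10.1
  have w2 := hw _ e01.1
  have w3 := hw _ e11.1
  have w4 := hw _ e10.2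
  have w5 := hw _ e01.2
  rw [h.polar_symm] at w1 w2 w3 w4 w5
  have h3 : e.repr w 3 = 0 := by linear_combination w3 - w2
  have h1 : e.repr w 1 = 0 := by
    apply mul_right_cancel₀ hρ0
    linear_combination w1 - h3
  have h2 : e.repr w 2 = 0 := by linear_combination w2 - ρ' * h1
  have h5 : e.repr w 5 = 0 := by linear_combination w4 - ρ * h1
  have h4 : e.repr w 4 = 0 := by linear_combination w5 - ρ' * h1
  apply e.ext_elem
  intro i
  rw [map_smul, ← h.zero_eq]
  fin_cases i <;> simp [h1, h2, h3, h4, h5]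

/-- A singular line through a point of the set has a direction v with v₁ = 0, which lies outside `S`
by `polar_ne_zero_of_mem`. Its other points project to an affine line of the (x₄,x₅)-plane, to which
`exists_second_point` applies. -/
theorem isHyperoval (h : IsAdapted Q S a δ e) (hS : IsEllipticSection Q S)
    (hδ : ¬ IsArtinSchreier δ) (hc : IsArtinSchreier (Q a)) :
    IsHyperoval Q (hyperovalOf Q S (zeroSet S (shiftedForm Q S a))) := by
  have hmem : ∀ {v : V} (hv : v ≠ 0), _ ↔ _ := fun hv => h.mk_mem_hyperovalOf hS hδ hv
  refine ⟨?_, ?_, ?_⟩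
  · intro p hp
    induction p using Projectivization.ind with
    | h v hv => exact (mk_mem_quadric hv).2 ((hmem hv).1 hp).1
  · exact ⟨_, (hmem (e.ne_zero 1)).2 h.inHyperoval_basis_one⟩
  · intro L hL hLQ
    rw [Set.encard_eq_zero]
    refine or_iff_not_imp_left.2 fun hne => ?_
    obtain ⟨p, hpL, hpH⟩ := Set.nonempty_iff_ne_empty.2 hne
    induction p using Projectivization.ind with
    | h u hu0 =>
    rw [mk_mem_pointsOf] at hpL
    rw [hmem] at hpH
    have hQL : ∀ w ∈ L, Q w = 0 := by
      intro w hw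
      by_cases hw0 : w = 0
      · rw [hw0, QuadraticMap.map_zero]
      · exact (mk_mem_quadric hw0).1 (hLQ ((mk_mem_pointsOf hw0).2 hw))
    obtain ⟨r, hr, hli, hspan⟩ := exists_lin_comb_of_finrank_two hL hpL hu0
    obtain ⟨hQu, hu1, hu2⟩ := hpH
    set v := r - (e.repr r 1 / e.repr u 1) • u with hvdef
    have hvL : v ∈ L := L.sub_mem hr (L.smul_mem _ hpL)
    have hv1 : e.repr v 1 = 0 := by
      rw [hvdef]
      simp [hu1]
    have hv0 : v ≠ 0 := by
      intro h0
      rw [LinearIndependent.pair_iff' hu0] at hli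
      exact hli _ (sub_eq_zero.1 h0).symm
    have hspan' : ∀ w ∈ L, ∃ s t : F, w = s • u + t • v := by
      intro w hw
      obtain ⟨s, t, rfl⟩ := hspan w hw
      refine ⟨s + t * (e.repr r 1 / e.repr u 1), t, ?_⟩
      rw [hvdef]
      module
    have hvu : QuadraticMap.polar Q v u = 0 := by
      rw [QuadraticMap.polar, hQL _ (L.add_mem hvL hpL), hQL _ hvL, hQL _ hpL]
      ring
    have hv45 : ¬ (e.repr v 4 = 0 ∧ e.repr v 5 = 0) := fun ⟨h4, h5⟩ =>
      h.polar_ne_zero_of_mem hδ hc hv0 (hQL v hvL) hv1 h4 h5 ⟨hQu, hu1, hu2⟩ hvu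
    obtain ⟨τ₀, hτ0, hτ⟩ := exists_second_point hδ hu1 hv45 hu2
    have hin : ∀ τ : F, InHyperoval Q δ e (u + τ • v) ↔ τ = 0 ∨ τ = τ₀ := by
      intro τ
      rw [← hτ, InHyperoval, hQL _ (L.add_mem hpL (L.smul_mem _ hvL))]
      simp [hv1, hu1]
    have hne0 : ∀ τ : F, u + τ • v ≠ 0 := by
      intro τ h0
      have h1 := congrArg (fun w => e.repr w 1) h0
      simp [hv1, hu1] at h1
    have hset : pointsOf L ∩ hyperovalOf Q S (zeroSet S (shiftedForm Q S a)) =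
        {Projectivization.mk F u hu0, Projectivization.mk F (u + τ₀ • v) (hne0 τ₀)} := by
      ext p
      induction p using Projectivization.ind with
      | h w hw0 =>
      rw [Set.mem_inter_iff, mk_mem_pointsOf, hmem, Set.mem_insert_iff, Set.mem_singleton_iff,
        Projectivization.mk_eq_mk_iff', Projectivization.mk_eq_mk_iff']
      constructor
      · rintro ⟨hwL, hw⟩
        obtain ⟨s, t, rfl⟩ := hspan' w hwL
        have hs : s ≠ 0 := by
          rintro rfl
          apply hw.2.1
          simp [hv1]
        have hst : s • u + t • v = s • (u + (t / s) • v) := by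
          rw [smul_add, smul_smul, mul_div_cancel₀ _ hs]
        rw [hst, inHyperoval_smul_iff hs, hin] at hw
        rcases hw with h0 | h0
        · left
          refine ⟨s, ?_⟩
          rw [hst, h0, zero_smul, add_zero]
        · right
          exact ⟨s, by rw [hst, h0]⟩
      · have hfin : ∀ τ : F, τ = 0 ∨ τ = τ₀ → (∃ s : F, s • (u + τ • v) = w) →
            w ∈ L ∧ InHyperoval Q δ e w := by
          rintro τ h1 ⟨s, rfl⟩
          have hs : s ≠ 0 := by
            rintro rfl
            exact hw0 (zero_smul _ _)
          refine ⟨L.smul_mem _ (L.add_mem hpL (L.smul_mem _ hvL)), ?_⟩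
          rw [inHyperoval_smul_iff hs, hin]
          exact h1
        rintro (⟨s, hs⟩ | h1)
        · exact hfin 0 (Or.inl rfl) ⟨s, by rw [zero_smul, add_zero, hs]⟩
        · exact hfin τ₀ (Or.inr rfl) h1
    rw [hset]
    apply Set.encard_pair
    rw [ne_eq, Projectivization.mk_eq_mk_iff']
    rintro ⟨s, hs⟩
    have h1 := congrArg (fun w => e.repr w 1) hs
    simp [hv1, hu1] at h1
    rw [h1, one_smul, add_eq_left, smul_eq_zero] at hs
    exact hs.elim hτ0 hv0

end IsAdapted

end Avoiding

/-! ### Collineations of the quadric and isomorphisms from equal parameters. -/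

section Semilinear

variable {F V : Type*} [Field F] [AddCommGroup V] [Module F V]

theorem exists_perm_of_semilinear (σ : F ≃+* F) (g : V ≃+ V)
    (hg : ∀ (a : F) (v : V), g (a • v) = σ a • g v) :
    ∃ E ∈ PGammaL F V, ∀ (v : V) (hv : v ≠ 0), E (Projectivization.mk F v hv) =
      Projectivization.mk F (g v) ((map_ne_zero_iff g g.injective).mpr hv) := by
  let f : V →ₛₗ[(σ : F →+* F)] V := { toFun := g, map_add' := map_add g, map_smul' := hg }
  let f' : V →ₛₗ[(σ.symm : F →+* F)] V :=
    { toFun := g.symm, map_add' := map_add g.symm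
      map_smul' := fun a v => by
        apply g.injective
        rw [AddEquiv.apply_symm_apply, hg, AddEquiv.apply_symm_apply]
        simp }
  have key : ∀ (v : V) (hv : v ≠ 0), Projectivization.map f g.injective
      (Projectivization.mk F v hv) =
        Projectivization.mk F (g v) ((map_ne_zero_iff g g.injective).mpr hv) := fun v hv => rfl
  have key' : ∀ (v : V) (hv : v ≠ 0), Projectivization.map f' g.symm.injective
      (Projectivization.mk F v hv) =
        Projectivization.mk F (g.symm v) ((map_ne_zero_iff g.symm g.symm.injective).mpr hv) :=
    fun v hv => rfl
  let E : Equiv.Perm (ℙ F V) :=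
    { toFun := Projectivization.map f g.injective
      invFun := Projectivization.map f' g.symm.injective
      left_inv := fun p => by
        induction p using Projectivization.ind with
        | h v hv => rw [key, key']; simp
      right_inv := fun p => by
        induction p using Projectivization.ind with
        | h v hv => rw [key', key]; simp }
  exact ⟨E, ⟨σ, g, hg, key⟩, key⟩

theorem image_eq_of_forall_mk {E : Equiv.Perm (ℙ F V)} {g : V ≃+ V}
    (hE : ∀ (v : V) (hv : v ≠ 0), E (Projectivization.mk F v hv) =
      Projectivization.mk F (g v) ((map_ne_zero_iff g g.injective).mpr hv))
    {A B : Set (ℙ F V)} (hAB : ∀ (v : V) (hv : v ≠ 0), Projectivization.mk F v hv ∈ A ↔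
      Projectivization.mk F (g v) ((map_ne_zero_iff g g.injective).mpr hv) ∈ B) : E '' A = B := by
  rw [Equiv.image_eq_preimage_symm]
  ext p
  obtain ⟨p, rfl⟩ := E.surjective p
  rw [Set.mem_preimage, Equiv.symm_apply_apply]
  induction p using Projectivization.ind with
  | h v hv => rw [hE, hAB]

theorem mk_mem_iff_of_image_eq {E : Equiv.Perm (ℙ F V)} {g : V ≃+ V}
    (hE : ∀ (v : V) (hv : v ≠ 0), E (Projectivization.mk F v hv) =
      Projectivization.mk F (g v) ((map_ne_zero_iff g g.injective).mpr hv))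
    {A B : Set (ℙ F V)} (hAB : E '' A = B) (v : V) (hv : v ≠ 0) :
    Projectivization.mk F (g v) ((map_ne_zero_iff g g.injective).mpr hv) ∈ B ↔
      Projectivization.mk F v hv ∈ A := by
  rw [← hAB, ← hE, E.injective.mem_set_image]

/-- The semilinear bijection mapping one basis to another. -/
noncomputable def semilinearOfBases (σ : F ≃+* F) (e e' : Module.Basis (Fin 6) F V) : V ≃+ V :=
  e.equivFun.toAddEquiv.trans
    ((AddEquiv.piCongrRight fun _ : Fin 6 => σ.toAddEquiv).trans e'.equivFun.symm.toAddEquiv)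

theorem repr_semilinearOfBases (σ : F ≃+* F) (e e' : Module.Basis (Fin 6) F V) (v : V)
    (i : Fin 6) : e'.repr (semilinearOfBases σ e e' v) i = σ (e.repr v i) :=
  repr_equivFun_symm e' _ i

theorem semilinearOfBases_smul (σ : F ≃+* F) (e e' : Module.Basis (Fin 6) F V) (a : F) (v : V) :
    semilinearOfBases σ e e' (a • v) = σ a • semilinearOfBases σ e e' v := by
  apply e'.ext_elem
  intro i
  simp [repr_semilinearOfBases]

theorem map_binForm (σ : F ≃+* F) (d x y : F) :
    σ (binForm d x y) = binForm (σ d) (σ x) (σ y) := by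
  simp [binForm]

variable [CharP F 2]

/-- A semilinear bijection preserving the zeros of a hyperbolic form is a semisimilarity. -/
theorem exists_factor_of_map_zeros {Q : QuadraticForm F V} (hQ : IsHyperbolic Q)
    {σ : F ≃+* F} {g : V ≃+ V} (hg : ∀ (a : F) (v : V), g (a • v) = σ a • g v)
    (hz : ∀ v, Q (g v) = 0 ↔ Q v = 0) : ∃ μ : F, μ ≠ 0 ∧ ∀ v, Q (g v) = μ * σ (Q v) := by
  obtain ⟨b, hb⟩ := hQ
  have hp := polar_of_hyperbolic hb
  have h0 : ∀ i, Q (g (b i)) = 0 := by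
    intro i
    rw [hz, hb]
    fin_cases i <;> simp
  have h1 : ∀ i j, QuadraticMap.polar Q (b i) (b j) = 0 → QuadraticMap.polar Q (g (b i)) (g (b j))
      = 0 := by
    intro i j hij
    have h2 : Q (b i + b j) = 0 := by
      rw [QuadraticMap.map_add Q, (hz _).1 (h0 i), (hz _).1 (h0 j), hij]
      ring
    rw [QuadraticMap.polar, ← map_add, (hz _).2 h2, h0, h0]
    ring
  have hpb : ∀ i j, QuadraticMap.polar Q (g (b i)) (g (b j)) = 0 ∨ (i, j) ∈
      ({(0, 1), (1, 0), (2, 3), (3, 2), (4, 5), (5, 4)} : Finset (Fin 6 × Fin 6)) := by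
    intro i j
    by_cases hij : QuadraticMap.polar Q (b i) (b j) = 0
    · exact Or.inl (h1 i j hij)
    · right
      rw [hp] at hij
      fin_cases i <;> fin_cases j <;> first | decide | (exfalso; apply hij; simp)
  have hexp : ∀ v, Q (g v) =
      σ (b.repr v 0 * b.repr v 1) * QuadraticMap.polar Q (g (b 0)) (g (b 1)) +
      σ (b.repr v 2 * b.repr v 3) * QuadraticMap.polar Q (g (b 2)) (g (b 3)) +
      σ (b.repr v 4 * b.repr v 5) * QuadraticMap.polar Q (g (b 4)) (g (b 5)) := by
    intro v
    have q : ∀ i j, (i, j) ∉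
        ({(0, 1), (1, 0), (2, 3), (3, 2), (4, 5), (5, 4)} : Finset (Fin 6 × Fin 6)) →
        QuadraticMap.polar Q (g (b i)) (g (b j)) = 0 := fun i j h => (hpb i j).resolve_right h
    conv_lhs => rw [← b.sum_repr v, Fin.sum_univ_six]
    simp only [map_add, hg, QuadraticMap.map_add Q, QuadraticMap.polar_add_left,
      QuadraticMap.polar_smul_left, QuadraticMap.polar_smul_right, QuadraticMap.map_smul, h0,
      smul_eq_mul, q 0 2 (by decide), q 0 3 (by decide), q 0 4 (by decide), q 0 5 (by decide),
      q 1 2 (by decide), q 1 3 (by decide), q 1 4 (by decide), q 1 5 (by decide),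
      q 2 4 (by decide), q 2 5 (by decide), q 3 4 (by decide), q 3 5 (by decide), map_mul]
    ring
  have h23 : QuadraticMap.polar Q (g (b 2)) (g (b 3)) = QuadraticMap.polar Q (g (b 0)) (g (b 1)) :=
      by
    -- This vector is singular since 1 + 1 = 0; singularity of its image equates two of the three
    -- surviving coefficients.
    have h2 : Q (b 0 + b 1 + b 2 + b 3) = 0 := by
      rw [hb]
      simp [CharTwo.add_self_eq_zero]
    rw [← hz, hexp] at h2
    simp at h2
    exact (CharTwo.add_eq_zero.1 h2).symm
  have h45 : QuadraticMap.polar Q (g (b 4)) (g (b 5)) = QuadraticMap.polar Q (g (b 0)) (g (b 1)) :=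
      by
    have h2 : Q (b 0 + b 1 + b 4 + b 5) = 0 := by
      rw [hb]
      simp [CharTwo.add_self_eq_zero]
    rw [← hz, hexp] at h2
    simp at h2
    exact (CharTwo.add_eq_zero.1 h2).symm
  refine ⟨QuadraticMap.polar Q (g (b 0)) (g (b 1)), fun hμ => ?_, fun v => ?_⟩
  · have h2 : Q (g (b 0 + b 1)) = 0 := by
      rw [map_add, QuadraticMap.map_add Q, h0, h0, hμ]
      ring
    rw [hz, hb] at h2
    simp at h2
  · rw [hexp, h23, h45, hb, map_add, map_add]
    ring

variable [Finite F]

/-- Choose adapted bases with parameters δ and σ(δ). Applying σ to coordinates then carries the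
equation of `Q` and the description of the hyperoval to those in the second basis. -/
theorem isoSetoid_of_map_eq {Q : QuadraticForm F V} (hQ : IsHyperbolicSpace Q)
    {S : Submodule F V} (hS : IsEllipticSection Q S) {a a' : V} (ha : a ∈ S) (ha0 : a ≠ 0)
    (ha' : a' ∈ S) (ha0' : a' ≠ 0) (σ : F ≃+* F) (hσ : σ (Q a) = Q a') :
    (isoSetoid Q).r (hyperovalOf Q S (zeroSet S (shiftedForm Q S a)))
      (hyperovalOf Q S (zeroSet S (shiftedForm Q S a'))) := by
  obtain ⟨δ, hδ⟩ := exists_not_isArtinSchreier F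
  have hδ' : ¬ IsArtinSchreier (σ δ) := by rwa [isArtinSchreier_map_iff]
  obtain ⟨e, he⟩ := exists_isAdapted hQ hS ha ha0 hδ
  obtain ⟨e', he'⟩ := exists_isAdapted hQ hS ha' ha0' hδ'
  have hrepr := repr_semilinearOfBases σ e e'
  have hQg : ∀ v, Q (semilinearOfBases σ e e' v) = σ (Q v) := by
    intro v
    rw [he'.apply_eq (semilinearOfBases σ e e' v), he.apply_eq v]
    simp only [hrepr, map_add, map_mul, map_pow, map_binForm, hσ]
  obtain ⟨E, hE, hEg⟩ := exists_perm_of_semilinear σ (semilinearOfBases σ e e')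
    (semilinearOfBases_smul σ e e')
  refine ⟨E, hE, image_eq_of_forall_mk hEg fun v hv => ?_, image_eq_of_forall_mk hEg fun v hv => ?_⟩
  · rw [mk_mem_quadric, mk_mem_quadric, hQg, map_eq_zero_iff σ σ.injective]
  · rw [he.mk_mem_hyperovalOf hS hδ, he'.mk_mem_hyperovalOf hS hδ', InHyperoval, InHyperoval, hQg]
    simp only [hrepr, ← map_binForm, ← map_pow, map_eq_zero_iff σ σ.injective, σ.injective.eq_iff,
      ne_eq]

end Semilinear

/-! ### Recovering the parameter from the hyperoval. -/

section Recovery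

variable {F V : Type*} [Field F] [AddCommGroup V] [Module F V]

/-- A semisimilarity of `Q` that maps the hyperoval given by the adapted basis `e` to the one
given by the adapted basis `e'`. -/
structure IsHyperovalMap (Q : QuadraticForm F V) (δ : F) (e e' : Module.Basis (Fin 6) F V)
    (σ : F ≃+* F) (g : V ≃+ V) (μ : F) : Prop where
  semilinear : ∀ (a : F) (v : V), g (a • v) = σ a • g v
  factor_ne_zero : μ ≠ 0
  map_apply : ∀ v, Q (g v) = μ * σ (Q v)
  inHyperoval_iff : ∀ v, InHyperoval Q δ e' (g v) ↔ InHyperoval Q δ e v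

namespace IsHyperovalMap

variable {Q : QuadraticForm F V} {S : Submodule F V} {a a' : V} {δ : F}
  {e e' : Module.Basis (Fin 6) F V} {σ : F ≃+* F} {g : V ≃+ V} {μ : F}

theorem map_polar (h : IsHyperovalMap Q δ e e' σ g μ) (v w : V) :
    QuadraticMap.polar Q (g v) (g w) = μ * σ (QuadraticMap.polar Q v w) := by
  rw [QuadraticMap.polar, ← map_add, h.map_apply, h.map_apply, h.map_apply, QuadraticMap.polar,
    map_sub, map_sub]
  ring

theorem polar_map_eq_zero_iff (h : IsHyperovalMap Q δ e e' σ g μ) {v w : V} :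
    QuadraticMap.polar Q (g v) (g w) = 0 ↔ QuadraticMap.polar Q v w = 0 := by
  rw [h.map_polar, mul_eq_zero, or_iff_right h.factor_ne_zero, map_eq_zero_iff σ σ.injective]

theorem avoids_map_iff (h : IsHyperovalMap Q δ e e' σ g μ) {k : V} :
    Avoids Q (InHyperoval Q δ e') (g k) ↔ Avoids Q (InHyperoval Q δ e) k := by
  rw [Avoids, Avoids, map_ne_zero_iff g g.injective, h.map_apply, mul_eq_zero,
    or_iff_right h.factor_ne_zero, map_eq_zero_iff σ σ.injective]
  refine and_congr_right fun _ => and_congr_right fun _ => ⟨fun H v hv => ?_, fun H v hv => ?_⟩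
  · exact fun h0 => H (g v) ((h.inHyperoval_iff v).2 hv) (h.polar_map_eq_zero_iff.2 h0)
  · obtain ⟨v, rfl⟩ := g.surjective v
    exact fun h0 => H v ((h.inHyperoval_iff v).1 hv) (h.polar_map_eq_zero_iff.1 h0)

variable [CharP F 2]

theorem repr_map_one (h : IsHyperovalMap Q δ e e' σ g μ) (he : IsAdapted Q S a δ e)
    (he' : IsAdapted Q S a' δ e') {t : F} (ht : t ≠ 0) (hg : g a = t • a') (v : V) :
    e'.repr (g v) 1 = t⁻¹ * μ * σ (e.repr v 1) := by
  have h1 := h.map_polar a v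
  rw [hg, QuadraticMap.polar_smul_left, he'.polar_left, he.polar_left, smul_eq_mul] at h1
  rw [mul_assoc, ← h1, inv_mul_cancel_left₀ ht]

/-- The preimage of m is orthogonal to e₀, to e₁, and to the plane ⟨e₂, e₃⟩ since `hN` places the
image of that plane in `S`. These span `S`. -/
theorem repr_symm_eq_zero (h : IsHyperovalMap Q δ e e' σ g μ) (he : IsAdapted Q S a δ e)
    (he' : IsAdapted Q S a' δ e') {t : F} (hg : g a = t • a')
    (hN : ∀ p q, e'.repr (g (e.equivFun.symm ![0, 0, p, q, 0, 0])) 4 = 0 ∧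
      e'.repr (g (e.equivFun.symm ![0, 0, p, q, 0, 0])) 5 = 0)
    {m : V} (hm : m ∈ polar Q S) (hm1 : QuadraticMap.polar Q m (g (e 1)) = 0) :
    e.repr (g.symm m) 0 = 0 ∧ e.repr (g.symm m) 1 = 0 ∧ e.repr (g.symm m) 2 = 0 ∧
      e.repr (g.symm m) 3 = 0 := by
  have key : ∀ w, QuadraticMap.polar Q m (g w) = 0 → QuadraticMap.polar Q (g.symm m) w = 0 := by
    intro w hw
    rw [← h.polar_map_eq_zero_iff, AddEquiv.apply_symm_apply, hw]
  have h1 := key _ hm1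
  have h0 := key a (by
    rw [hg, QuadraticMap.polar_smul_right, QuadraticMap.polar_comm, ← he'.zero_eq,
      mem_polar_iff.1 hm _ (he'.basis_mem (by decide)), smul_zero])
  obtain ⟨k0, k1, k2, k3⟩ := (he'.mem_polar_iff m).1 hm
  have hpq : ∀ p q, QuadraticMap.polar Q (g.symm m) (e.equivFun.symm ![0, 0, p, q, 0, 0]) = 0 := by
    intro p q
    apply key
    rw [he'.polar_eq, k0, k1, k2, k3, (hN p q).1, (hN p q).2]
    ring
  have h2 := hpq 0 1
  have h3 := hpq 1 0
  rw [he.polar_symm] at h2 h3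
  rw [QuadraticMap.polar_comm, he.polar_left] at h0
  rw [he.polar_eq] at h1
  simp at h1
  refine ⟨h1, h0, by linear_combination h2, by linear_combination h3⟩

variable [Finite F]

theorem apply_eq_zero (h : IsHyperovalMap Q δ e e' σ g μ) (he : IsAdapted Q S a δ e)
    (he' : IsAdapted Q S a' δ e') (hδ : ¬ IsArtinSchreier δ) (hc' : IsArtinSchreier (Q a'))
    (ha : Q a = 0) : Q a' = 0 := by
  by_contra ha'
  obtain ⟨k, l, hk, hl, hkl⟩ := he'.exists_avoids_pair hδ hc' ha'
  obtain ⟨k, rfl⟩ := g.surjective k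
  obtain ⟨l, rfl⟩ := g.surjective l
  exact hkl (h.polar_map_eq_zero_iff.2
    (he.polar_eq_zero_of_avoids hδ ha (h.avoids_map_iff.1 hk) (h.avoids_map_iff.1 hl)))

/-- Avoiding vectors are preserved in both directions and are orthogonal to a, so g(a) is orthogonal
to all avoiding vectors of the second hyperoval. -/
theorem exists_map_eq_smul (h : IsHyperovalMap Q δ e e' σ g μ) (he : IsAdapted Q S a δ e)
    (he' : IsAdapted Q S a' δ e') (hδ : ¬ IsArtinSchreier δ) (hc' : IsArtinSchreier (Q a'))
    (ha' : Q a' ≠ 0) : ∃ t : F, t ≠ 0 ∧ g a = t • a' := by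
  have h1 := he'.eq_smul_of_orthogonal_avoids hδ hc' ha' (w := g a) fun k hk => by
    obtain ⟨k, rfl⟩ := g.surjective k
    rw [h.polar_map_eq_zero_iff, he.polar_left]
    exact he.repr_one_eq_zero_of_avoids hδ (h.avoids_map_iff.1 hk)
  refine ⟨_, fun h0 => ?_, h1⟩
  rw [h0, zero_smul, map_eq_zero_iff g g.injective] at h1
  apply e.ne_zero 0
  rw [he.zero_eq, h1]

/-- The points xa + e₁ + τn with τ²N(p,q) = Q(a)x² + x belong to the hyperoval. If g(n) were outside
`S`, their images would project to one affine line of the (x₄,x₅)-plane, leaving only two values of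
σ(τ); for q > 4 at least three values of τ occur. -/
theorem repr_map_eq_zero {F : Type*} [Field F] [Fintype F] [CharP F 2] [Module F V]
    {Q : QuadraticForm F V} {S : Submodule F V} {a a' : V} {δ : F}
    {e e' : Module.Basis (Fin 6) F V} {σ : F ≃+* F} {g : V ≃+ V} {μ : F}
    (h : IsHyperovalMap Q δ e e' σ g μ) (he : IsAdapted Q S a δ e)
    (he' : IsAdapted Q S a' δ e') (hδ : ¬ IsArtinSchreier δ) (hF : 4 < Fintype.card F)
    {t : F} (ht : t ≠ 0) (hg : g a = t • a') (p q : F) :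
    e'.repr (g (e.equivFun.symm ![0, 0, p, q, 0, 0])) 4 = 0 ∧
      e'.repr (g (e.equivFun.symm ![0, 0, p, q, 0, 0])) 5 = 0 := by
  classical
  by_contra hne
  set n := e.equivFun.symm ![0, 0, p, q, 0, 0] with hn
  have hpq : binForm δ p q ≠ 0 := by
    intro h0
    obtain ⟨rfl, rfl⟩ := binForm_eq_zero hδ h0
    have : n = 0 := by
      rw [hn, LinearEquiv.symm_apply_eq, map_zero]
      ext i
      fin_cases i <;> rfl
    simp [this] at hne
  have h1 := h.repr_map_one he he' ht hg
  obtain ⟨-, hb1, hb⟩ := (h.inHyperoval_iff _).2 he.inHyperoval_basis_one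
  have hz : e'.repr (g (e 1)) 1 ≠ 0 := hb1
  obtain ⟨τ₀, -, hτ⟩ := exists_second_point hδ hz hne hb
  have key : ∀ x τ : F, τ ^ 2 * binForm δ p q = Q a * x ^ 2 + x → σ τ = 0 ∨ σ τ = τ₀ := by
    intro x τ hx
    have hv : InHyperoval Q δ e (x • a + e 1 + τ • n) := by
      have : x • a + e 1 + τ • n = e.equivFun.symm ![x, 1, τ * p, τ * q, 0, 0] := by
        rw [LinearEquiv.eq_symm_apply, ← he.zero_eq]
        ext i
        rw [Module.Basis.equivFun_apply]
        simp only [map_add, map_smul, hn, Finsupp.add_apply, Finsupp.smul_apply,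
          repr_equivFun_symm, smul_eq_mul]
        fin_cases i <;> simp
      rw [this, he.inHyperoval_symm, binForm_smul, hx]
      refine ⟨?_, one_ne_zero, Or.inl (by simp [binForm])⟩
      unfold binForm
      linear_combination (Q a * x ^ 2 + x) * CharTwo.two_eq_zero (R := F)
    have hv' := ((h.inHyperoval_iff _).2 hv).2.2
    have ha4 : e'.repr a' 4 = 0 := by rw [← he'.zero_eq]; simp
    have ha5 : e'.repr a' 5 = 0 := by rw [← he'.zero_eq]; simp
    have hx1 : e'.repr (g (x • a + e 1 + τ • n)) 1 = e'.repr (g (e 1)) 1 := by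
      rw [h1, h1, ← he.zero_eq]
      simp [-Module.Basis.equivFun_symm_apply, hn, repr_equivFun_symm]
    rw [hx1] at hv'
    rw [← hτ]
    simpa [h.semilinear, hg, ha4, ha5] using hv'
  -- The additive map x ↦ Q(a)x² + x has kernel {0, Q(a)⁻¹}, which is {0} when Q(a) = 0 because then
  -- the inverse is 0. So x₁ and x₂ are taken outside the kernel and in different cosets of it.
  obtain ⟨x₁, -, hx₁⟩ := Finset.exists_mem_notMem_of_card_lt_card
    (s := ({0, (Q a)⁻¹} : Finset F)) (t := Finset.univ)
    (lt_of_le_of_lt Finset.card_le_two (by rw [Finset.card_univ]; omega))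
  obtain ⟨x₂, -, hx₂⟩ := Finset.exists_mem_notMem_of_card_lt_card
    (s := ({0, (Q a)⁻¹, x₁, x₁ + (Q a)⁻¹} : Finset F)) (t := Finset.univ)
    (lt_of_le_of_lt Finset.card_le_four (by rw [Finset.card_univ]; omega))
  simp only [Finset.mem_insert, Finset.mem_singleton, not_or] at hx₁ hx₂
  have hroot : ∀ x, Q a * x ^ 2 + x = 0 → x = 0 ∨ x = (Q a)⁻¹ := by
    intro x hx
    have h2 : x * (Q a * x + 1) = 0 := by linear_combination hx
    rcases mul_eq_zero.1 h2 with h2 | h2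
    · exact Or.inl h2
    · right
      rw [CharTwo.add_eq_zero] at h2
      exact eq_inv_of_mul_eq_one_right h2
  obtain ⟨τ₁, hτ₁⟩ := exists_sq_eq ((Q a * x₁ ^ 2 + x₁) / binForm δ p q)
  obtain ⟨τ₂, hτ₂⟩ := exists_sq_eq ((Q a * x₂ ^ 2 + x₂) / binForm δ p q)
  rw [eq_div_iff hpq] at hτ₁ hτ₂
  have hne₁ : σ τ₁ ≠ 0 := by
    intro h0
    rw [(map_eq_zero_iff σ σ.injective).1 h0] at hτ₁
    rcases hroot x₁ (by rw [← hτ₁]; ring) with h2 | h2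
    · exact hx₁.1 h2
    · exact hx₁.2 h2
  have hne₂ : σ τ₂ ≠ 0 := by
    intro h0
    rw [(map_eq_zero_iff σ σ.injective).1 h0] at hτ₂
    rcases hroot x₂ (by rw [← hτ₂]; ring) with h2 | h2
    · exact hx₂.1 h2
    · exact hx₂.2.1 h2
  have h12 : τ₁ = τ₂ := σ.injective
    (((key _ _ hτ₁).resolve_left hne₁).trans ((key _ _ hτ₂).resolve_left hne₂).symm)
  have hsum : Q a * (x₁ + x₂) ^ 2 + (x₁ + x₂) = 0 := by
    rw [h12, hτ₂] at hτ₁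
    linear_combination hτ₁ + (Q a * x₁ ^ 2 + x₁ + Q a * x₁ * x₂) * CharTwo.two_eq_zero (R := F)
  rcases hroot _ hsum with h2 | h2
  · exact hx₂.2.2.1 (CharTwo.add_eq_zero.1 h2).symm
  · exact hx₂.2.2.2 (by rw [← h2, ← add_assoc, CharTwo.add_self_eq_zero, zero_add])

/-- Comparing Q(g(a)) = t²Q(a') with μσ(Q(a)) reduces the claim to μ = t². Points with x₁ = 1 have
images with second coordinate t⁻¹μ, so it suffices to exhibit one on the hyperoval whose image has
N-value μ ≠ 0 in its last two coordinates. -/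
theorem map_apply_eq (h : IsHyperovalMap Q δ e e' σ g μ) (he : IsAdapted Q S a δ e)
    (he' : IsAdapted Q S a' δ e') (hδ : ¬ IsArtinSchreier δ) {t : F} (ht : t ≠ 0)
    (hg : g a = t • a')
    (hN : ∀ p q, e'.repr (g (e.equivFun.symm ![0, 0, p, q, 0, 0])) 4 = 0 ∧
      e'.repr (g (e.equivFun.symm ![0, 0, p, q, 0, 0])) 5 = 0) : σ (Q a) = Q a' := by
  have hμ0 := h.factor_ne_zero
  have h1 := h.repr_map_one he he' ht hg
  have hN0 : binForm δ (0 : F) 0 = 0 := by simp [binForm]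
  suffices hμ : μ = (t⁻¹ * μ) ^ 2 by
    have h2 := h.map_apply a
    have h3 : μ = t ^ 2 := by
      field_simp at hμ
      exact hμ.symm
    rw [hg, QuadraticMap.map_smul, smul_eq_mul, h3, ← sq] at h2
    exact (mul_left_cancel₀ (pow_ne_zero 2 ht) h2).symm
  have hmem : ∀ m ∈ polar Q S, QuadraticMap.polar Q m (g (e 1)) = 0 → ∃ x y : F,
      g.symm m = e.equivFun.symm ![0, 0, 0, 0, x, y] ∧ Q m = μ * σ (binForm δ x y) := by
    intro m hm hm1
    obtain ⟨k0, k1, k2, k3⟩ := h.repr_symm_eq_zero he he' hg hN hm hm1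
    have hl : g.symm m = e.equivFun.symm
        ![0, 0, 0, 0, e.repr (g.symm m) 4, e.repr (g.symm m) 5] := by
      rw [LinearEquiv.eq_symm_apply]
      ext i
      rw [Module.Basis.equivFun_apply]
      fin_cases i <;> simp [k0, k1, k2, k3]
    refine ⟨_, _, hl, ?_⟩
    have h2 := h.map_apply (g.symm m)
    rw [AddEquiv.apply_symm_apply] at h2
    rw [h2, hl, he.apply_symm]
    simp [-Module.Basis.equivFun_symm_apply, hN0, repr_equivFun_symm]
  have hsplit : ∀ r x y : F, e.equivFun.symm ![0, 1, r, 0, x, y] =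
      e 1 + e.equivFun.symm ![0, 0, r, 0, 0, 0] + e.equivFun.symm ![0, 0, 0, 0, x, y] := by
    intro r x y
    apply e.ext_elem
    intro i
    simp only [map_add, Finsupp.add_apply, repr_equivFun_symm]
    fin_cases i <;> simp
  have hb1 : e'.repr (g (e 1)) 1 = t⁻¹ * μ := by rw [h1]; simp
  by_cases hb : e'.repr (g (e 1)) 4 = 0 ∧ e'.repr (g (e 1)) 5 = 0
  -- If g(e₁) lies in `S`, a unit vector orthogonal to `S` is pulled back and scaled to N-value 1;
  -- adding e₁ + e₂ gives the required point.
  · obtain ⟨hb4, hb5⟩ := hb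
    have hm4 : e' 4 ∈ polar Q S := by
      rw [he'.mem_polar_iff]
      simp
    obtain ⟨x, y, hxy, hQxy⟩ := hmem _ hm4 (by
      rw [he'.polar_eq, hb4, hb5]
      simp)
    have hQ4 : Q (e' 4) = 1 := by
      rw [he'.apply_eq]
      simp [binForm]
    rw [hQ4] at hQxy
    obtain ⟨r, hr⟩ := exists_sq_eq (binForm δ x y)⁻¹
    have hbxy : binForm δ x y ≠ 0 := by
      intro h0
      rw [h0] at hQxy
      simp at hQxy
    have hv : InHyperoval Q δ e (e.equivFun.symm ![0, 1, 1, 0, r * x, r * y]) := by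
      rw [he.inHyperoval_symm, binForm_smul, hr, inv_mul_cancel₀ hbxy]
      refine ⟨?_, one_ne_zero, Or.inr (one_pow 2).symm⟩
      unfold binForm
      linear_combination CharTwo.two_eq_zero (R := F)
    have hv' := ((h.inHyperoval_iff _).2 hv).2.2
    have hsm : e.equivFun.symm ![0, 0, 0, 0, r * x, r * y] = r • g.symm (e' 4) := by
      rw [hxy, ← map_smul]
      congr 1
      ext i
      fin_cases i <;> simp
    have hx1 : e'.repr (g (e.equivFun.symm ![0, 1, 1, 0, r * x, r * y])) 1 = t⁻¹ * μ := by
      rw [h1, repr_equivFun_symm]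
      simp
    rw [hx1, hsplit, hsm] at hv'
    simp only [map_add, h.semilinear, AddEquiv.apply_symm_apply, map_smul, Finsupp.add_apply,
      Finsupp.smul_apply, hb4, hb5, (hN 1 0).1, (hN 1 0).2] at hv'
    have hrμ : σ r ^ 2 = μ := by
      rw [← map_pow, hr, map_inv₀]
      exact inv_eq_of_mul_eq_one_left hQxy.symm
    have hbin : binForm δ (σ r) 0 = μ := by simp [binForm, hrμ]
    simp [hbin, hμ0] at hv'
    exact hv'
  -- Otherwise the component of g(e₁) orthogonal to `S` is pulled back and added to e₁, with an
  -- e₂-term restoring singularity. The image falls into `S`, hence into the second hyperoval, which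
  -- forces N(x,y) = 1; the required point is e₁ itself.
  · set y4 := e'.repr (g (e 1)) 4 with hy4
    set y5 := e'.repr (g (e 1)) 5 with hy5
    have hbin : binForm δ y4 y5 ≠ 0 := fun h0 => hb (binForm_eq_zero hδ h0)
    obtain ⟨x, y, hxy, hQxy⟩ := hmem (e'.equivFun.symm ![0, 0, 0, 0, y4, y5])
      (by rw [he'.mem_polar_iff]; simp [-Module.Basis.equivFun_symm_apply, repr_equivFun_symm])
      (by
        rw [QuadraticMap.polar_comm, he'.polar_symm, ← hy4, ← hy5]
        linear_combination y4 * y5 * CharTwo.two_eq_zero (R := F))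
    rw [he'.apply_symm] at hQxy
    obtain ⟨r, hr⟩ := exists_binForm_eq δ (binForm δ x y)
    have hv' : InHyperoval Q δ e' (g (e.equivFun.symm ![0, 1, r, 0, x, y])) := by
      refine ⟨?_, ?_, Or.inl ?_⟩
      · rw [h.map_apply, he.apply_symm, hr]
        simp [CharTwo.add_self_eq_zero]
      · rw [h1, repr_equivFun_symm]
        simp [ht, hμ0]
      · rw [hsplit, ← hxy]
        simp only [map_add, AddEquiv.apply_symm_apply, Finsupp.add_apply, (hN r 0).1, (hN r 0).2,
          repr_equivFun_symm, ← hy4, ← hy5]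
        simp [CharTwo.add_self_eq_zero, hN0]
    have hv := ((h.inHyperoval_iff _).1 hv').2.2
    simp only [repr_equivFun_symm] at hv
    have hxy0 : binForm δ x y ≠ 0 := by
      intro h0
      rw [h0] at hQxy
      simp [hN0] at hQxy
      exact hbin hQxy
    have hxy1 : binForm δ x y = 1 := (hv.resolve_left hxy0).trans (one_pow 2)
    have hb2 := ((h.inHyperoval_iff _).2 he.inHyperoval_basis_one).2.2
    rw [← hy4, ← hy5, hb1] at hb2
    rw [← hb2.resolve_left hbin]
    rw [hxy1] at hQxy
    simp [hN0] at hQxy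
    exact hQxy.symm

end IsHyperovalMap

end Recovery

/-! ### Counting isomorphism classes by orbits. -/

section Count

theorem ncard_image_eq_of_iff {α β γ : Type*} (f : α → β) (g : α → γ) (A : Set α)
    (hfg : ∀ a ∈ A, ∀ b ∈ A, f a = f b ↔ g a = g b) : (f '' A).ncard = (g '' A).ncard := by
  refine Set.ncard_congr (fun y hy => g hy.choose) ?_ ?_ ?_
  · exact fun y hy => ⟨_, hy.choose_spec.1, rfl⟩
  · intro y z hy hz h
    rw [← hy.choose_spec.2, ← hz.choose_spec.2]
    exact (hfg _ hy.choose_spec.1 _ hz.choose_spec.1).2 h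
  · rintro _ ⟨a, ha, rfl⟩
    have h : f a ∈ f '' A := ⟨a, ha, rfl⟩
    exact ⟨f a, h, (hfg _ h.choose_spec.1 _ ha).1 h.choose_spec.2⟩

theorem mk_orbitRel_eq_iff {F : Type*} [Field F] (x y : F) :
    (Quotient.mk (MulAction.orbitRel (RingAut F) F) x = Quotient.mk _ y) ↔
      ∃ σ : F ≃+* F, σ x = y := by
  rw [eq_comm, Quotient.eq]
  exact Iff.rfl

variable {F V : Type*} [Field F] [Fintype F] [AddCommGroup V] [Module F V]

theorem ncard_orbits_trace_zero (h : ℕ) :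
    (Quotient.mk (MulAction.orbitRel (RingAut F) F) '' {x : F | trace h x = 0}).ncard =
      numTraceZeroOrbits F h + 1 := by
  have h0 : trace h (0 : F) = 0 :=
    Finset.sum_eq_zero fun i _ => zero_pow (pow_ne_zero i two_ne_zero)
  have hset : {x : F | trace h x = 0} = insert 0 {x : F | x ≠ 0 ∧ trace h x = 0} := by
    ext x
    by_cases hx : x = 0
    · simp [hx, h0]
    · simp [hx]
  rw [hset, Set.image_insert_eq, Set.ncard_insert_of_notMem, numTraceZeroOrbits]
  rintro ⟨x, ⟨hx, -⟩, h1⟩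
  obtain ⟨σ, hσ⟩ := (mk_orbitRel_eq_iff x 0).1 h1
  exact hx ((map_eq_zero_iff σ σ.injective).1 hσ)

variable [CharP F 2]

theorem exists_mem_apply_eq {Q : QuadraticForm F V} (hQ : IsHyperbolicSpace Q)
    {S : Submodule F V} (hS : IsEllipticSection Q S) (c : F) : ∃ a ∈ S, a ≠ 0 ∧ Q a = c := by
  obtain ⟨a, ha, ha0⟩ := hS.exists_ne_zero_mem
  obtain ⟨δ, hδ⟩ := exists_not_isArtinSchreier F
  obtain ⟨e, he⟩ := exists_isAdapted hQ hS ha ha0 hδ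
  -- The value here is Q(a) + (c + Q(a)) = c.
  refine ⟨e.equivFun.symm ![1, c + Q a, 0, 0, 0, 0], ?_, fun h0 => ?_, ?_⟩
  · rw [he.mem_iff, repr_equivFun_symm, repr_equivFun_symm]
    exact ⟨rfl, rfl⟩
  · have h1 := repr_equivFun_symm e ![1, c + Q a, 0, 0, 0, 0] 0
    rw [h0, LinearEquiv.map_zero] at h1
    exact zero_ne_one h1
  · rw [he.apply_symm]
    unfold binForm
    linear_combination Q a * CharTwo.two_eq_zero (R := F)

/-- This covers the fields with at most four elements, to which `repr_map_eq_zero` does not apply.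
-/
theorem eq_one_of_trace_eq_zero {h : ℕ} (hh : h < 3) {c : F} (hc : trace h c = 0) (hc0 : c ≠ 0)
    (hq : Fintype.card F = 2 ^ h) : c = 1 := by
  have h1 := Fintype.one_lt_card (α := F)
  interval_cases h
  · omega
  · exact absurd (by simpa [trace] using hc) hc0
  · have h2 : c * (c + 1) = 0 := by
      simp only [trace, Finset.sum_range_succ, Finset.sum_range_zero] at hc
      linear_combination hc
    exact CharTwo.add_eq_zero.1 ((mul_eq_zero.1 h2).resolve_left hc0)

theorem exists_map_eq_of_isoSetoid {h : ℕ} (hq : Fintype.card F = 2 ^ h)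
    {Q : QuadraticForm F V} (hQ : IsHyperbolic Q) {S : Submodule F V}
    (hS : IsEllipticSection Q S) {a a' : V} (ha : a ∈ S) (ha0 : a ≠ 0)
    (hc : IsArtinSchreier (Q a)) (ha' : a' ∈ S) (ha0' : a' ≠ 0) (hc' : IsArtinSchreier (Q a'))
    (hiso : (isoSetoid Q).r (hyperovalOf Q S (zeroSet S (shiftedForm Q S a)))
      (hyperovalOf Q S (zeroSet S (shiftedForm Q S a')))) : ∃ σ : F ≃+* F, σ (Q a) = Q a' := by
  obtain ⟨δ, hδ⟩ := exists_not_isArtinSchreier F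
  have main : ∀ {a a' : V}, a ∈ S → a ≠ 0 → IsArtinSchreier (Q a) → a' ∈ S → a' ≠ 0 →
      IsArtinSchreier (Q a') → (isoSetoid Q).r (hyperovalOf Q S (zeroSet S (shiftedForm Q S a)))
      (hyperovalOf Q S (zeroSet S (shiftedForm Q S a'))) → ∃ e e' σ g μ, IsAdapted Q S a δ e ∧
      IsAdapted Q S a' δ e' ∧ IsHyperovalMap Q δ e e' σ g μ := by
    rintro a a' ha ha0 hc ha' ha0' hc' ⟨E, ⟨σ, g, hg, hE⟩, hEQ, hEH⟩
    obtain ⟨e, he⟩ := exists_isAdapted hQ.isHyperbolicSpace hS ha ha0 hδ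
    obtain ⟨e', he'⟩ := exists_isAdapted hQ.isHyperbolicSpace hS ha' ha0' hδ
    obtain ⟨μ, hμ, hgμ⟩ := exists_factor_of_map_zeros hQ hg fun v => by
      by_cases hv : v = 0
      · simp [hv]
      · have := mk_mem_iff_of_image_eq hE hEQ v hv
        rwa [mk_mem_quadric, mk_mem_quadric] at this
    refine ⟨e, e', σ, g, μ, he, he', hg, hμ, hgμ, fun v => ?_⟩
    by_cases hv : v = 0
    · simp [hv, InHyperoval]
    · have := mk_mem_iff_of_image_eq hE hEH v hv
      rwa [he.mk_mem_hyperovalOf hS hδ, he'.mk_mem_hyperovalOf hS hδ] at this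
  have hzero : Q a = 0 ↔ Q a' = 0 := by
    constructor
    · obtain ⟨e, e', σ, g, μ, he, he', hm⟩ := main ha ha0 hc ha' ha0' hc' hiso
      exact hm.apply_eq_zero he he' hδ hc'
    · obtain ⟨e, e', σ, g, μ, he, he', hm⟩ := main ha' ha0' hc' ha ha0 hc
        ((isoSetoid Q).symm' hiso)
      exact hm.apply_eq_zero he he' hδ hc
  by_cases h0 : Q a' = 0
  · exact ⟨RingEquiv.refl F, by rw [hzero.2 h0, h0, map_zero]⟩
  by_cases hh : h < 3
  · refine ⟨RingEquiv.refl F, ?_⟩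
    rw [eq_one_of_trace_eq_zero hh ((trace_eq_zero_iff hq).2 hc) (mt hzero.1 h0) hq,
      eq_one_of_trace_eq_zero hh ((trace_eq_zero_iff hq).2 hc') h0 hq, map_one]
  · have hF : 4 < Fintype.card F := by
      rw [hq]
      calc 4 < 2 ^ 3 := by norm_num
        _ ≤ 2 ^ h := Nat.pow_le_pow_right (by norm_num) (by omega)
    obtain ⟨e, e', σ, g, μ, he, he', hm⟩ := main ha ha0 hc ha' ha0' hc' hiso
    obtain ⟨t, ht, hg⟩ := hm.exists_map_eq_smul he he' hδ hc' h0
    exact ⟨σ, hm.map_apply_eq he he' hδ ht hg (hm.repr_map_eq_zero he he' hδ hF ht hg)⟩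

end Count

end KleinHyperoval

theorem corollary14 {F V : Type*} [Field F] [Fintype F] [AddCommGroup V] [Module F V]
    (h : ℕ) (hq : Fintype.card F = 2 ^ h)
    (Q : QuadraticForm F V) (hQ : KleinHyperoval.IsHyperbolic Q)
    (S : Submodule F V)
    (hS : KleinHyperoval.IsEllipticQuadric S (KleinHyperoval.sectionOf Q S)) :
    (∀ H ∈ KleinHyperoval.classicalHyperovals Q S, KleinHyperoval.IsHyperoval Q H) ∧
    KleinHyperoval.numIsoClasses Q (KleinHyperoval.classicalHyperovals Q S) =
      KleinHyperoval.numTraceZeroOrbits F h + 1 := by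
  have := KleinHyperoval.charP_two_of_card hq
  have hQ' := hQ.isHyperbolicSpace
  have hS' := KleinHyperoval.isEllipticSection_of_isEllipticQuadric hS
  rw [KleinHyperoval.classicalHyperovals_eq hQ' hS']
  constructor
  · rintro _ ⟨a, ⟨ha, ha0, hc⟩, rfl⟩
    obtain ⟨δ, hδ⟩ := KleinHyperoval.exists_not_isArtinSchreier F
    obtain ⟨e, he⟩ := KleinHyperoval.exists_isAdapted hQ' hS' ha ha0 hδ
    exact he.isHyperoval hS' hδ hc
  · rw [← KleinHyperoval.ncard_orbits_trace_zero]
    have himage : {x : F | KleinHyperoval.trace h x = 0} =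
        Q '' {a | a ∈ S ∧ a ≠ 0 ∧ KleinHyperoval.IsArtinSchreier (Q a)} := by
      ext c
      rw [Set.mem_ofPred_eq, KleinHyperoval.trace_eq_zero_iff hq]
      constructor
      · intro hc
        obtain ⟨a, ha, ha0, rfl⟩ := KleinHyperoval.exists_mem_apply_eq hQ' hS' c
        exact ⟨a, ⟨ha, ha0, hc⟩, rfl⟩
      · rintro ⟨a, ⟨-, -, hc⟩, rfl⟩
        exact hc
    rw [himage, KleinHyperoval.numIsoClasses, Set.image_image, Set.image_image]
    -- Classes and orbits are both images of the same set of vectors a, so only the fibres need to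
    -- be compared.
    apply KleinHyperoval.ncard_image_eq_of_iff
    rintro a ⟨ha, ha0, hc⟩ a' ⟨ha', ha0', hc'⟩
    rw [KleinHyperoval.mk_orbitRel_eq_iff, Quotient.eq]
    exact ⟨KleinHyperoval.exists_map_eq_of_isoSetoid hq hQ hS' ha ha0 hc ha' ha0' hc',
      fun ⟨σ, hσ⟩ => KleinHyperoval.isoSetoid_of_map_eq hQ' hS' ha ha0 ha' ha0' σ hσ⟩
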